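/- Let $\mathfrak{S}_3$ be the set of permutations $\pi$ of the three candidates $\{1,2,3\}$, where $\pi$ encodes the ranking in which candidate $a$ precedes candidate $b$ if and only if $\pi(a)<\pi(b)$, and let $$d_\tau(\pi,\pi')=\#\{(a,b): a<b,\ \mathbf 1[\pi(a)<\pi(b)]\neq \mathbf 1[\pi'(a)<\pi'(b)]\}$$ be Kendall's tau distance. For $n\ge 1$ voters and $\beta\in\mathbb{R}$, the mean-field model is the probability measure $Q_n=Q_{n,\beta}$ on profiles $x\in\mathfrak{S}_3^n$ given by $$Q_n(x)=\frac1{Z_n(\beta)}\exp\Big(-\frac{\beta}{n}\sum_{i=1}^n\sum_{j=1}^n d_\tau(x_i,x_j)\Big),$$ where $Z_n(\beta)$ is the normalizing constant. Let $E_n$ be the event that there is a Condorcet winner under pairwise majority, i.e. a candidate $a$ such that, for every other candidate $b$, strictly more voters rank $a$ before $b$ than rank $b$ before $a$. (1) If $\beta<3/4$, then $$\lim_{n\to\infty}Q_n(E_n)=\frac{3}{2\pi}\arccos\Big(\frac{3}{4\beta-9}\Big).$$ (2) If $\beta>3/4$, then $\lim_{n\to\infty}Q_n(E_n)=1$. Moreover,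 there is a constant $c_\beta>0$, depending only on $\beta$, such that for every $n\ge1$ the probability of a paradox satisfies $Q_n(E_n^c)\le 2e^{-c_\beta n}$. -/

import Mathlib

open Filter Topology

noncomputable section

namespace MeanFieldVoting

/-- A ranking of `q` candidates is a permutation `π` of `Fin q`, with `π a` the position of
candidate `a`: candidate `a` is ranked before candidate `b` when `π a < π b`. A voting profile of
`n` voters assigns a ranking to each voter. -/
abbrev Profile (q n : ℕ) : Type := Fin n → Equiv.Perm (Fin q)

/-- Kendall's tau distance: the number of pairs `a < b` that the two rankings order oppositely. -/
def kendallTau {q : ℕ} (π π' : Equiv.Perm (Fin q)) : ℕ :=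
  (Finset.univ.filter fun p : Fin q × Fin q =>
    p.1 < p.2 ∧ ¬ (π p.1 < π p.2 ↔ π' p.1 < π' p.2)).card

/-- The unnormalized Gibbs weight of a profile in the mean-field model at inverse temperature
`β`. -/
def gibbsWeight {q n : ℕ} (β : ℝ) (x : Profile q n) : ℝ :=
  Real.exp (-(β / (n : ℝ)) * ∑ i, ∑ j, (kendallTau (x i) (x j) : ℝ))

/-- The normalizing constant of the mean-field model. -/
def partitionFunction (q n : ℕ) (β : ℝ) : ℝ :=
  ∑ x : Profile q n, gibbsWeight β x

/-- The probability mass function of the mean-field model. -/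
def gibbsMass {q n : ℕ} (β : ℝ) (x : Profile q n) : ℝ :=
  gibbsWeight β x / partitionFunction q n β

open Classical in
/-- The probability of an event `E` in the mean-field model with `q` candidates and `n` voters at
inverse temperature `β`. -/
def prob (q n : ℕ) (β : ℝ) (E : Set (Profile q n)) : ℝ :=
  ∑ x : Profile q n with x ∈ E, gibbsMass β x

/-- Candidate `a` wins the pairwise majority election against candidate `b`: strictly more voters
rank `a` before `b` than `b` before `a`. -/
def Beats {q n : ℕ} (x : Profile q n) (a b : Fin q) : Prop :=
  (Finset.univ.filter fun i => x i b < x i a).card <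
    (Finset.univ.filter fun i => x i a < x i b).card

/-- A Condorcet winner wins the pairwise majority election against every other candidate. -/
def IsCondorcetWinner {q n : ℕ} (x : Profile q n) (a : Fin q) : Prop :=
  ∀ b, b ≠ a → Beats x a b

/-- The event that there is a Condorcet winner. -/
def condorcetEvent (q n : ℕ) : Set (Profile q n) :=
  {x | ∃ a, IsCondorcetWinner x a}

end MeanFieldVoting

end

/-! Encode a ranking by its signs on the cyclic pairs (0,1), (1,2), (2,0). Kendall's tau is then
affine in the inner product of sign vectors, so the model weights a profile by exp(β|S|²/(2n)),
where S in ℤ³ is the vector of majority margins, and a Condorcet winner is a sign condition on S. A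
uniform vote has covariance eigenvalues 1/3, 4/3, 4/3. The Gaussian picture survives exactly while
β·4/3 < 1, whence the threshold 3/4.

For β > 3/4 a large-deviation bound is used. Linearizing |S|² by a tilt θ gives the exponential rate
log M(θ) - |θ|²/(2β), with M the moment generating function of one vote. The numerator over profiles
without a winner is at most polynomial times the n-th power of the maximal rate on the closed cone
without a winner (`sum_marginWeight_le`). The partition function is at least the n-th power of the
rate at any point (`growthRate_pow_le_sum_marginWeight`). It remains to beat every point of that
cone strictly elsewhere (`exists_growthRate_gt`).

For β < 3/4 the Hubbard-Stratonovich transformation turns exp(β|S|²/(2n)) into a Gaussian average of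
exponentials linear in S. The sum over profiles factorizes, and dominated convergence yields a
Gaussian limit for the characteristic function of S/√n (`tendsto_sum_gibbsMass_mul_cexp`). The two
margins of a candidate become Gaussian with correlation ρ = 3/(9-4β). They are both positive with
probability arccos(-ρ)/(2π) (`correlatedGaussian_quadrant`), and the three candidates give disjoint
events. -/

namespace MeanFieldVoting

/-! ### Cyclic sign vectors, margins and the Gibbs measure. -/

/-- The `±1` vector recording the preferences of a ranking on the cyclic pairs `(k, k + 1)`. -/
def cyclicVote (π : Equiv.Perm (Fin 3)) (k : Fin 3) : ℤ :=
  if π k < π (k + 1) then 1 else -1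

/-- The majority margin of `k` over `k + 1`. -/
def margin {n : ℕ} (x : Profile 3 n) (k : Fin 3) : ℤ := ∑ i, cyclicVote (x i) k

theorem two_mul_kendallTau (π π' : Equiv.Perm (Fin 3)) :
    2 * (kendallTau π π' : ℤ) = 3 - ∑ k, cyclicVote π k * cyclicVote π' k := by
  revert π π'
  unfold kendallTau cyclicVote
  decide

/-- Transitivity excludes exactly the two cyclic patterns (1,1,1) and (-1,-1,-1); each other sign
vector comes from one ranking. -/
theorem map_cyclicVote_univ :
    (Finset.univ : Finset (Equiv.Perm (Fin 3))).val.map cyclicVote =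
      {![1, 1, -1], ![1, -1, 1], ![-1, 1, 1], ![-1, -1, 1], ![-1, 1, -1], ![1, -1, -1]} := by
  unfold cyclicVote
  decide

theorem sum_comp_cyclicVote {A : Type*} [AddCommMonoid A] (f : (Fin 3 → ℤ) → A) :
    ∑ π, f (cyclicVote π) = f ![1, 1, -1] + f ![1, -1, 1] + f ![-1, 1, 1] + f ![-1, -1, 1] +
      f ![-1, 1, -1] + f ![1, -1, -1] := by
  have h : ∑ π, f (cyclicVote π) = (((Finset.univ : Finset (Equiv.Perm (Fin 3))).val.map
      cyclicVote).map f).sum := by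
    rw [Multiset.map_map]; rfl
  rw [h, map_cyclicVote_univ]
  simp [add_assoc]

theorem sum_ite_lt_eq_card_sub_card {q n : ℕ} (x : Profile q n) {a b : Fin q} (hab : a ≠ b) :
    ∑ i, (if x i a < x i b then (1 : ℤ) else -1) =
      (Finset.univ.filter fun i => x i a < x i b).card -
        (Finset.univ.filter fun i => x i b < x i a).card := by
  have h : ∀ i, (if x i a < x i b then (1 : ℤ) else -1) =
      (if x i a < x i b then (1 : ℤ) else 0) - if x i b < x i a then (1 : ℤ) else 0 := by
    intro i
    have : x i a ≠ x i b := fun h => hab ((x i).injective h)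
    rcases lt_or_gt_of_ne this with h | h
    · simp [h, h.not_gt]
    · simp [h, h.not_gt]
  simp_rw [h, Finset.sum_sub_distrib, Finset.sum_boole]

theorem beats_add_one {n : ℕ} (x : Profile 3 n) (a : Fin 3) :
    Beats x a (a + 1) ↔ 0 < margin x a := by
  have hne : a ≠ a + 1 := by revert a; decide
  have := sum_ite_lt_eq_card_sub_card x hne
  unfold Beats margin cyclicVote
  omega

theorem beats_add_two {n : ℕ} (x : Profile 3 n) (a : Fin 3) :
    Beats x a (a + 2) ↔ margin x (a + 2) < 0 := by
  have hne : a + 2 ≠ a := by revert a; decide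
  have h3 : a + 2 + 1 = a := by revert a; decide
  have := sum_ite_lt_eq_card_sub_card x hne
  unfold Beats margin cyclicVote
  rw [h3]
  omega

/-- The opponents of `a` are `a + 1` and `a + 2`. The cyclic pair joining `a + 2` to `a` starts at
`a + 2`, hence the reversed sign. -/
theorem isCondorcetWinner_iff {n : ℕ} (x : Profile 3 n) (a : Fin 3) :
    IsCondorcetWinner x a ↔ 0 < margin x a ∧ margin x (a + 2) < 0 := by
  rw [← beats_add_one, ← beats_add_two]
  constructor
  · intro h
    exact ⟨h _ (by clear h; revert a; decide), h _ (by clear h; revert a; decide)⟩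
  · rintro ⟨h1, h2⟩ b hb
    have : b = a + 1 ∨ b = a + 2 := by clear h1 h2; revert a b; decide
    rcases this with rfl | rfl <;> assumption

theorem IsCondorcetWinner.unique {n : ℕ} {x : Profile 3 n} {a b : Fin 3}
    (ha : IsCondorcetWinner x a) (hb : IsCondorcetWinner x b) : a = b := by
  by_contra hab
  have h1 := ha b (Ne.symm hab)
  have h2 := hb a hab
  exact lt_asymm h1 h2

theorem margin_bounds {n : ℕ} (x : Profile 3 n) (k : Fin 3) :
    -(n : ℤ) ≤ margin x k ∧ margin x k ≤ n := by
  have h : |margin x k| ≤ n := by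
    refine (Finset.abs_sum_le_sum_abs _ _).trans ?_
    refine (Finset.sum_le_sum (g := fun _ => 1) fun i _ => ?_).trans (by simp)
    unfold cyclicVote; split_ifs <;> simp
  exact abs_le.1 h

/-- The Gibbs weight of a profile up to a factor that only depends on `n`. -/
noncomputable def marginWeight {n : ℕ} (β : ℝ) (x : Profile 3 n) : ℝ :=
  Real.exp (β / (2 * n) * ∑ k, (margin x k : ℝ) ^ 2)

theorem marginWeight_pos {n : ℕ} (β : ℝ) (x : Profile 3 n) : 0 < marginWeight β x :=
  Real.exp_pos _

theorem sum_kendallTau {n : ℕ} (x : Profile 3 n) :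
    ∑ i, ∑ j, (kendallTau (x i) (x j) : ℝ) =
      3 / 2 * n ^ 2 - 1 / 2 * ∑ k, (margin x k : ℝ) ^ 2 := by
  have h : ∀ i j, (kendallTau (x i) (x j) : ℝ) =
      3 / 2 - 1 / 2 * ∑ k, (cyclicVote (x i) k : ℝ) * cyclicVote (x j) k := by
    intro i j
    have := two_mul_kendallTau (x i) (x j)
    have h2 : 2 * (kendallTau (x i) (x j) : ℝ) =
        3 - ∑ k, (cyclicVote (x i) k : ℝ) * cyclicVote (x j) k := by exact_mod_cast this
    linarith
  simp_rw [h, Finset.sum_sub_distrib, ← Finset.mul_sum]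
  congr 1
  · simp; ring
  · congr 1
    have : ∀ i, ∑ j, ∑ k, (cyclicVote (x i) k : ℝ) * cyclicVote (x j) k =
        ∑ k, (cyclicVote (x i) k : ℝ) * margin x k := by
      intro i
      rw [Finset.sum_comm]
      simp [margin, Finset.mul_sum]
    simp_rw [this]
    rw [Finset.sum_comm]
    refine Finset.sum_congr rfl fun k _ => ?_
    rw [← Finset.sum_mul, sq]
    simp [margin]

theorem gibbsWeight_eq {n : ℕ} (β : ℝ) (x : Profile 3 n) :
    gibbsWeight β x = Real.exp (-(3 / 2 * β * n)) * marginWeight β x := by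
  unfold gibbsWeight marginWeight
  rw [sum_kendallTau, ← Real.exp_add]
  congr 1
  rcases Nat.eq_zero_or_pos n with rfl | hn
  · simp
  · have : (n : ℝ) ≠ 0 := by positivity
    field_simp
    ring

theorem gibbsMass_eq {n : ℕ} (β : ℝ) (x : Profile 3 n) :
    gibbsMass β x = marginWeight β x / ∑ y : Profile 3 n, marginWeight β y := by
  unfold gibbsMass partitionFunction
  simp_rw [gibbsWeight_eq, ← Finset.mul_sum]
  exact mul_div_mul_left _ _ (Real.exp_ne_zero _)

theorem sum_marginWeight_pos (n : ℕ) (β : ℝ) : 0 < ∑ y : Profile 3 n, marginWeight β y :=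
  Finset.sum_pos (fun _ _ => marginWeight_pos _ _) Finset.univ_nonempty

theorem gibbsMass_nonneg {n : ℕ} (β : ℝ) (x : Profile 3 n) : 0 ≤ gibbsMass β x := by
  rw [gibbsMass_eq]
  exact div_nonneg (marginWeight_pos _ _).le (sum_marginWeight_pos _ _).le

theorem sum_gibbsMass (n : ℕ) (β : ℝ) : ∑ x : Profile 3 n, gibbsMass β x = 1 := by
  simp_rw [gibbsMass_eq, ← Finset.sum_div]
  exact div_self (sum_marginWeight_pos _ _).ne'

theorem prob_le_one (n : ℕ) (β : ℝ) (E : Set (Profile 3 n)) : prob 3 n β E ≤ 1 := by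
  classical
  rw [← sum_gibbsMass n β]
  exact Finset.sum_le_sum_of_subset_of_nonneg (Finset.filter_subset _ _)
    fun _ _ _ => gibbsMass_nonneg _ _

theorem prob_add_prob_compl (n : ℕ) (β : ℝ) (E : Set (Profile 3 n)) :
    prob 3 n β E + prob 3 n β Eᶜ = 1 := by
  classical
  rw [← sum_gibbsMass n β]
  unfold prob
  simp only [Set.mem_compl_iff]
  convert Finset.sum_filter_add_sum_filter_not Finset.univ (fun x => x ∈ E) _

/-! ### Generating functions of the margins. -/

/-- The moment generating function of the vote of a uniformly random ranking. -/
noncomputable def voteMGF (θ : Fin 3 → ℝ) : ℝ :=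
  (Real.cosh (θ 0 + θ 1 - θ 2) + Real.cosh (θ 0 - θ 1 + θ 2) + Real.cosh (-θ 0 + θ 1 + θ 2)) / 3

/-- The complex moment generating function of the vote of a uniformly random ranking. -/
noncomputable def voteComplexMGF (z : Fin 3 → ℂ) : ℂ :=
  (Complex.cosh (z 0 + z 1 - z 2) + Complex.cosh (z 0 - z 1 + z 2) +
    Complex.cosh (-z 0 + z 1 + z 2)) / 3

theorem sum_exp_cyclicVote (z : Fin 3 → ℂ) :
    ∑ π, Complex.exp (∑ k, z k * cyclicVote π k) = 6 * voteComplexMGF z := by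
  rw [sum_comp_cyclicVote fun y => Complex.exp (∑ k, z k * (y k : ℂ))]
  simp only [Fin.sum_univ_three, voteComplexMGF, Complex.cosh]
  simp
  ring_nf

theorem ofReal_voteMGF (θ : Fin 3 → ℝ) :
    ((voteMGF θ : ℝ) : ℂ) = voteComplexMGF fun k => (θ k : ℂ) := by
  simp [voteMGF, voteComplexMGF]

theorem sum_cexp_margin (n : ℕ) (z : Fin 3 → ℂ) :
    ∑ x : Profile 3 n, Complex.exp (∑ k, z k * margin x k) = (6 * voteComplexMGF z) ^ n := by
  rw [← sum_exp_cyclicVote, Finset.sum_pow']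
  simp only [Fintype.piFinset_univ]
  refine Finset.sum_congr rfl fun x _ => ?_
  rw [← Complex.exp_sum, Finset.sum_comm]
  simp [margin, Finset.mul_sum]

theorem sum_exp_margin (n : ℕ) (θ : Fin 3 → ℝ) :
    ∑ x : Profile 3 n, Real.exp (∑ k, θ k * margin x k) = (6 * voteMGF θ) ^ n := by
  have := sum_cexp_margin n fun k => (θ k : ℂ)
  rw [← ofReal_voteMGF] at this
  exact_mod_cast this

/-! ### The growth rate is never maximal without a Condorcet winner. -/

/-- The rate `exp (log M(θ) - |θ|² / (2β))` whose supremum over `θ` is the exponential growth rate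
of the partition function. -/
noncomputable def growthRate (β a b c : ℝ) : ℝ :=
  (Real.cosh (a + b - c) + Real.cosh (a - b + c) + Real.cosh (-a + b + c)) / 3 *
    Real.exp (-((a ^ 2 + b ^ 2 + c ^ 2) / (2 * β)))

theorem growthRate_rotate (β a b c : ℝ) : growthRate β b c a = growthRate β a b c := by
  unfold growthRate
  rw [show b + c - a = -a + b + c by ring, show b - c + a = a + b - c by ring,
    show -b + c + a = a - b + c by ring, show b ^ 2 + c ^ 2 + a ^ 2 = a ^ 2 + b ^ 2 + c ^ 2 by ring]
  ring

theorem growthRate_neg (β a b c : ℝ) : growthRate β (-a) (-b) (-c) = growthRate β a b c := by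
  unfold growthRate
  rw [show -a + -b - -c = -(a + b - c) by ring, show -a - -b + -c = -(a - b + c) by ring,
    show - -a + -b + -c = -(-a + b + c) by ring]
  simp only [Real.cosh_neg, even_two, Even.neg_pow]

/-- The flip keeps the norm and swaps two of the three cosines; the remaining one gains 2 sinh(a+b)
sinh c. -/
theorem growthRate_lt_flip (β : ℝ) {a b c : ℝ} (hc : 0 < c) (hab : 0 < a + b) :
    growthRate β a b c < growthRate β a b (-c) := by
  unfold growthRate
  rw [even_two.neg_pow]
  refine mul_lt_mul_of_pos_right ?_ (Real.exp_pos _)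
  have h1 : Real.cosh (a + b - -c) - Real.cosh (a + b - c) = 2 * Real.sinh (a + b) * Real.sinh c := by
    rw [sub_neg_eq_add, Real.cosh_add, Real.cosh_sub]; ring
  have h2 : Real.cosh (a - b + c) = Real.cosh (-a + b + -c) := by
    rw [← Real.cosh_neg]; congr 1; ring
  have h3 : Real.cosh (-a + b + c) = Real.cosh (a - b + -c) := by
    rw [← Real.cosh_neg]; congr 1; ring
  have h4 : 0 < 2 * Real.sinh (a + b) * Real.sinh c := by
    have := Real.sinh_pos_iff.2 hc
    have := Real.sinh_pos_iff.2 hab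
    positivity
  rw [h2, h3]
  linarith

/-- The derivative in `c` at 0 is a nonzero multiple of sinh(a+b): the Gaussian factor is even in
`c`, and the other two cosines cancel. -/
theorem exists_growthRate_gt_of_add_ne_zero (β : ℝ) {a b : ℝ} (hab : a + b ≠ 0) :
    ∃ c, growthRate β a b 0 < growthRate β a b c := by
  by_contra! h
  have hmax : IsLocalMax (fun c => growthRate β a b c) 0 := Eventually.of_forall h
  have hE : HasDerivAt (fun c => Real.exp (-((a ^ 2 + b ^ 2 + c ^ 2) / (2 * β)))) 0 0 := by
    have := (((hasDerivAt_pow 2 (0 : ℝ)).const_add (a ^ 2 + b ^ 2)).div_const (2 * β)).neg.exp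
    simpa using this
  have hC : HasDerivAt (fun c => (Real.cosh (a + b - c) + Real.cosh (a - b + c) +
      Real.cosh (-a + b + c)) / 3) (-Real.sinh (a + b) / 3) 0 := by
    have h1 := ((hasDerivAt_id (0 : ℝ)).const_sub (a + b)).cosh
    have h2 := ((hasDerivAt_id (0 : ℝ)).const_add (a - b)).cosh
    have h3 := ((hasDerivAt_id (0 : ℝ)).const_add (-a + b)).cosh
    refine (((h1.add h2).add h3).div_const 3).congr_deriv ?_
    have : Real.sinh (-a + b) = -Real.sinh (a - b) := by
      rw [← Real.sinh_neg]; congr 1; ring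
    simp [this]
  have := hmax.hasDerivAt_eq_zero (hC.mul hE)
  have hs : Real.sinh (a + b) ≠ 0 := by simpa using hab
  simp [hs] at this

/-- Compare power series: beyond order zero this is 2·3ⁿ ≤ 4ⁿ + 2, with equality for n = 1, 2 and
first strict at n = 3. -/
theorem one_add_two_mul_cosh_sqrt_three_mul_lt {v : ℝ} (hv : v ≠ 0) :
    1 + 2 * Real.cosh (√3 * v) < Real.cosh (2 * v) + 2 * Real.cosh v := by
  have h1 : HasSum (fun n : ℕ => (0 : ℝ) ^ (2 * n) / (2 * n).factorial +
      2 * ((√3 * v) ^ (2 * n) / (2 * n).factorial)) (1 + 2 * Real.cosh (√3 * v)) := by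
    have := (Real.hasSum_cosh 0).add ((Real.hasSum_cosh (√3 * v)).mul_left 2)
    simpa only [Real.cosh_zero] using this
  have h2 := (Real.hasSum_cosh (2 * v)).add ((Real.hasSum_cosh v).mul_left 2)
  have h3 : ∀ n : ℕ, (√3 * v) ^ (2 * n) = 3 ^ n * (v ^ 2) ^ n := by
    intro n
    rw [pow_mul, mul_pow, Real.sq_sqrt (by norm_num), mul_pow]
  have h4 : ∀ n : ℕ, (2 * v) ^ (2 * n) = 4 ^ n * (v ^ 2) ^ n := by
    intro n
    rw [pow_mul, mul_pow, mul_pow]; norm_num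
  have h5 : ∀ n : ℕ, (2 : ℝ) * 3 ^ (n + 1) ≤ 4 ^ (n + 1) + 2 := by
    intro n
    induction n with
    | zero => norm_num
    | succ n ih =>
      have : (1 : ℝ) ≤ 3 ^ n := one_le_pow₀ (by norm_num)
      have : (3 : ℝ) ≤ 3 ^ (n + 1) := by rw [pow_succ]; linarith
      rw [pow_succ, pow_succ 4 (n + 1)]
      linarith
  refine hasSum_lt (i := 3) (fun n => ?_) ?_ h1 h2
  · rcases n with _ | n
    · norm_num
    · rw [h3, h4, pow_mul v]
      have : (0 : ℝ) ≤ (v ^ 2) ^ (n + 1) := by positivity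
      rw [← mul_div_assoc, ← mul_div_assoc, ← add_div, ← add_div]
      refine div_le_div_of_nonneg_right ?_ (by positivity)
      rw [zero_pow (by omega)]
      nlinarith [h5 n]
  · have : 0 < v ^ 6 := by positivity
    simp only [h3, h4, pow_mul v]
    rw [← mul_div_assoc, ← mul_div_assoc, ← add_div, ← add_div]
    refine div_lt_div_of_pos_right ?_ (by positivity)
    norm_num
    nlinarith

theorem exists_growthRate_gt_of_ne_zero (β : ℝ) {t : ℝ} (ht : t ≠ 0) :
    ∃ a b c, growthRate β t (-t) 0 < growthRate β a b c := by
  have h3 : (√3) ^ 2 = 3 := Real.sq_sqrt (by norm_num)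
  have h3' : √3 ≠ 0 := by positivity
  -- A point of the same norm in the plane of coordinate sum zero, so only the hyperbolic cosines
  -- have to be compared.
  refine ⟨t / √3, t / √3, -2 * (t / √3), ?_⟩
  have h := one_add_two_mul_cosh_sqrt_three_mul_lt (v := 2 * (t / √3)) (by positivity)
  have e1 : √3 * (2 * (t / √3)) = 2 * t := by field_simp
  rw [e1] at h
  unfold growthRate
  have e2 : (t / √3) ^ 2 + (t / √3) ^ 2 + (-2 * (t / √3)) ^ 2 = t ^ 2 + (-t) ^ 2 + 0 ^ 2 := by
    rw [mul_pow, div_pow, h3]; ring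
  rw [e2]
  refine mul_lt_mul_of_pos_right ?_ (Real.exp_pos _)
  have e3 : -t + -t + 0 = -(2 * t) := by ring
  have e4 : t / √3 - t / √3 + -2 * (t / √3) = -(2 * (t / √3)) := by ring
  have e5 : -(t / √3) + t / √3 + -2 * (t / √3) = -(2 * (t / √3)) := by ring
  have e6 : t / √3 + t / √3 - -2 * (t / √3) = 2 * (2 * (t / √3)) := by ring
  have e7 : t - -t + 0 = 2 * t := by ring
  have e8 : t + -t - 0 = 0 := by ring
  rw [e3, e4, e5, e6, e7, e8, Real.cosh_neg, Real.cosh_neg, Real.cosh_zero]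
  linarith

theorem exists_growthRate_gt_one {β : ℝ} (hβ : 3 / 4 < β) :
    ∃ a b c, growthRate β 0 0 0 < growthRate β a b c := by
  -- The witness (√s, -√s, 0) lies in the 4/3-eigenspace. To first order the gain is 4s/3 against a
  -- loss s/β; this `s` is small enough to absorb the product term.
  set s := (β - 3 / 4) / 2 with hs
  have hs0 : 0 < s := by rw [hs]; linarith
  have hst : √s ^ 2 = s := Real.sq_sqrt hs0.le
  refine ⟨√s, -√s, 0, ?_⟩
  unfold growthRate
  have e3 : -√s + -√s + 0 = -(2 * √s) := by ring
  have e7 : √s - -√s + 0 = 2 * √s := by ring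
  have e8 : √s + -√s - 0 = 0 := by ring
  have e9 : (√s ^ 2 + (-√s) ^ 2 + 0 ^ 2) / (2 * β) = s / β := by
    rw [even_two.neg_pow, hst]; field_simp; ring
  rw [e3, e7, e8, e9]
  have h1 : 1 + 2 * s ≤ Real.cosh (2 * √s) := by
    have h := pow_le_pow_left₀ (Real.sqrt_nonneg s) (Real.self_le_sinh_iff.2 (Real.sqrt_nonneg s)) 2
    rw [hst] at h
    rw [Real.cosh_two_mul, Real.cosh_sq]
    linarith
  have h2 : 1 - s / β ≤ Real.exp (-(s / β)) := by
    have := Real.add_one_le_exp (-(s / β)); linarith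
  have h4 : 1 < (1 + 4 / 3 * s) * (1 - s / β) := by
    have hb : 0 < β := by linarith
    have : (1 + 4 / 3 * s) * (1 - s / β) - 1 = s / β * (4 / 3 * (β - 3 / 4 - s)) := by
      field_simp; ring
    have h5 : 0 < s / β * (4 / 3 * (β - 3 / 4 - s)) := by
      have : β - 3 / 4 - s = s := by rw [hs]; ring
      rw [this]; positivity
    linarith
  have h6 : (1 + 4 / 3 * s) * (1 - s / β) ≤ (1 + 4 / 3 * s) * Real.exp (-(s / β)) :=
    mul_le_mul_of_nonneg_left h2 (by positivity)
  have h7 : (1 + 4 / 3 * s) * Real.exp (-(s / β)) ≤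
      (Real.cosh 0 + Real.cosh (2 * √s) + Real.cosh (-(2 * √s))) / 3 * Real.exp (-(s / β)) := by
    refine mul_le_mul_of_nonneg_right ?_ (Real.exp_pos _).le
    rw [Real.cosh_neg, Real.cosh_zero]; linarith
  have h8 : (Real.cosh (0 + 0 - 0) + Real.cosh (0 - 0 + 0) + Real.cosh (-0 + 0 + 0)) / 3 *
      Real.exp (-((0 ^ 2 + 0 ^ 2 + 0 ^ 2) / (2 * β))) = 1 := by
    norm_num
  rw [h8]
  linarith

/-- The rate is not maximized at a point with `c = 0`, a tie between two candidates. -/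
theorem exists_growthRate_gt_of_tie {β : ℝ} (hβ : 3 / 4 < β) (a b : ℝ) :
    ∃ a' b' c', growthRate β a b 0 < growthRate β a' b' c' := by
  by_cases hab : a + b = 0
  · obtain rfl : b = -a := by linarith
    by_cases ha : a = 0
    · subst ha
      simpa using exists_growthRate_gt_one hβ
    · exact exists_growthRate_gt_of_ne_zero β ha
  · obtain ⟨c, hc⟩ := exists_growthRate_gt_of_add_ne_zero β hab
    exact ⟨a, b, c, hc⟩

/-- The rate is not maximized at a margin vector without a Condorcet winner. -/
theorem exists_growthRate_gt {β : ℝ} (hβ : 3 / 4 < β) {a b c : ℝ} (h1 : ¬ (0 < a ∧ c < 0))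
    (h2 : ¬ (0 < b ∧ a < 0)) (h3 : ¬ (0 < c ∧ b < 0)) :
    ∃ a' b' c', growthRate β a b c < growthRate β a' b' c' := by
  by_cases hc : c = 0
  · subst hc; exact exists_growthRate_gt_of_tie hβ a b
  by_cases ha : a = 0
  · subst ha
    simpa only [growthRate_rotate] using exists_growthRate_gt_of_tie hβ b c
  by_cases hb : b = 0
  · subst hb
    rw [← growthRate_rotate, ← growthRate_rotate]
    exact exists_growthRate_gt_of_tie hβ c a
  -- With no zero coordinate, the absence of a winner forces all signs equal; the negative case
  -- reduces to the positive one by global negation.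
  rcases lt_or_gt_of_ne ha with ha | ha <;> rcases lt_or_gt_of_ne hb with hb | hb <;>
    rcases lt_or_gt_of_ne hc with hc | hc <;> try tauto
  · refine ⟨-a, -b, - -c, ?_⟩
    rw [← growthRate_neg]
    exact growthRate_lt_flip β (by linarith) (by linarith)
  · exact ⟨a, b, -c, growthRate_lt_flip β hc (by linarith)⟩

theorem growthRate_pos (β a b c : ℝ) : 0 < growthRate β a b c := by
  unfold growthRate
  have h1 := Real.cosh_pos (a + b - c)
  have h2 := Real.cosh_pos (a - b + c)
  have h3 := Real.cosh_pos (-a + b + c)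
  positivity

theorem growthRate_eq (β : ℝ) (θ : Fin 3 → ℝ) :
    growthRate β (θ 0) (θ 1) (θ 2) =
      voteMGF θ * Real.exp (-((∑ k, θ k ^ 2) / (2 * β))) := by
  rw [Fin.sum_univ_three]; rfl

theorem sum_exp_tilt (n : ℕ) (β : ℝ) (θ : Fin 3 → ℝ) :
    ∑ x : Profile 3 n, Real.exp (∑ k, θ k * margin x k - n * ((∑ k, θ k ^ 2) / (2 * β))) =
      (6 * growthRate β (θ 0) (θ 1) (θ 2)) ^ n := by
  simp_rw [sub_eq_add_neg, Real.exp_add, ← Finset.sum_mul]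
  rw [sum_exp_margin, growthRate_eq, ← mul_assoc, mul_pow (6 * voteMGF θ), ← Real.exp_nat_mul, mul_neg]

/-! ### Low temperature: exponential decay of the paradox. -/

/-- Lower bound on the partition function. -/
theorem growthRate_pow_le_sum_marginWeight {n : ℕ} (hn : n ≠ 0) {β : ℝ} (hβ : 0 < β) (a b c : ℝ) :
    (6 * growthRate β a b c) ^ n ≤ ∑ x : Profile 3 n, marginWeight β x := by
  have := sum_exp_tilt n β ![a, b, c]
  simp only [Matrix.cons_val_zero, Matrix.cons_val_one, Matrix.cons_val] at this
  rw [← this]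
  refine Finset.sum_le_sum fun x _ => Real.exp_le_exp.2 ?_
  rw [Finset.sum_div, Finset.mul_sum, Finset.mul_sum, ← Finset.sum_sub_distrib]
  refine Finset.sum_le_sum fun k _ => ?_
  have hn : (0 : ℝ) < n := by positivity
  generalize (![a, b, c] : Fin 3 → ℝ) k = t
  -- Completing the square: the tilted exponent lies below the quadratic one, with equality at t = β
  -- · margin / n.
  have h : β / (2 * n) * (margin x k : ℝ) ^ 2 - (t * margin x k - n * (t ^ 2 / (2 * β))) =
      (β * margin x k - n * t) ^ 2 / (2 * n * β) := by
    field_simp; ring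
  have : 0 ≤ (β * margin x k - n * t) ^ 2 / (2 * n * β) := by positivity
  linarith

/-- Upper bound on the weight of an event, by the method of types. -/
theorem sum_marginWeight_le {n : ℕ} (hn : n ≠ 0) {β m : ℝ} (hβ : 0 < β) (hm : 0 < m) (E : Finset (Profile 3 n))
    (hE : ∀ x ∈ E, growthRate β (β / n * margin x 0) (β / n * margin x 1) (β / n * margin x 2) ≤ m) :
    ∑ x ∈ E, marginWeight β x ≤ (2 * n + 1) ^ 3 * (6 * m) ^ n := by
  classical
  have hn' : (0 : ℝ) < n := by positivity
  rw [← Finset.sum_fiberwise_of_maps_to (t := E.image margin)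
    (fun x hx => Finset.mem_image_of_mem _ hx)]
  have hcard : (E.image margin).card ≤ (2 * n + 1) ^ 3 := by
    have hsub : E.image margin ⊆ Fintype.piFinset fun _ : Fin 3 => Finset.Icc (-(n : ℤ)) n := by
      intro s hs
      obtain ⟨x, -, rfl⟩ := Finset.mem_image.1 hs
      exact Fintype.mem_piFinset.2 fun k => Finset.mem_Icc.2 (margin_bounds x k)
    refine (Finset.card_le_card hsub).trans (le_of_eq ?_)
    rw [Fintype.card_piFinset]
    simp
    omega
  have hterm : ∀ s ∈ E.image margin,
      ∑ x ∈ E with margin x = s, marginWeight β x ≤ (6 * m) ^ n := by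
    intro s hs
    obtain ⟨x₁, hx₁, rfl⟩ := Finset.mem_image.1 hs
    -- On a fibre of `margin` the optimal tilt is constant, and there linearization is exact.
    have h1 : ∀ x ∈ E.filter (fun x => margin x = margin x₁), marginWeight β x =
        Real.exp (∑ k, (β / n * margin x₁ k) * margin x k -
          n * ((∑ k, (β / n * margin x₁ k) ^ 2) / (2 * β))) := by
      intro x hx
      unfold marginWeight
      rw [(Finset.mem_filter.1 hx).2, Finset.sum_div, Finset.mul_sum, Finset.mul_sum,
        ← Finset.sum_sub_distrib]
      congr 1
      refine Finset.sum_congr rfl fun k _ => ?_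
      field_simp
      ring
    rw [Finset.sum_congr rfl h1]
    refine (Finset.sum_le_sum_of_subset_of_nonneg (Finset.subset_univ _)
      fun _ _ _ => (Real.exp_pos _).le).trans ?_
    rw [sum_exp_tilt n β fun k => β / n * margin x₁ k]
    have := growthRate_pos β (β / n * margin x₁ 0) (β / n * margin x₁ 1) (β / n * margin x₁ 2)
    have := hE x₁ hx₁
    gcongr
  refine (Finset.sum_le_card_nsmul _ _ _ hterm).trans ?_
  rw [nsmul_eq_mul]
  refine mul_le_mul_of_nonneg_right ?_ (by positivity)
  exact_mod_cast hcard

theorem growthRate_le_one {β a b c : ℝ} (hβ : 0 < β) (h : 6 * β ≤ max |a| (max |b| |c|)) :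
    growthRate β a b c ≤ 1 := by
  have hcosh : ∀ x : ℝ, |x| ≤ |a| + |b| + |c| → Real.cosh x ≤ Real.exp (|a| + |b| + |c|) := by
    intro x hx
    rw [← Real.cosh_abs]
    refine le_trans ?_ (Real.exp_le_exp.2 hx)
    rw [← Real.cosh_add_sinh]
    have := Real.sinh_nonneg_iff.2 (abs_nonneg x)
    linarith
  -- With R the largest absolute value, the left side is at most 3R and the squares sum to at least
  -- R²; R ≥ 6β makes the latter dominate.
  have key : |a| + |b| + |c| ≤ (a ^ 2 + b ^ 2 + c ^ 2) / (2 * β) := by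
    rw [le_div_iff₀ (by positivity), ← sq_abs a, ← sq_abs b, ← sq_abs c]
    have ha := abs_nonneg a
    have hb := abs_nonneg b
    have hc := abs_nonneg c
    set R := max |a| (max |b| |c|) with hR
    have h1 : |a| ≤ R := le_max_left _ _
    have h2 : |b| ≤ R := (le_max_left _ _).trans (le_max_right _ _)
    have h3 : |c| ≤ R := (le_max_right _ _).trans (le_max_right _ _)
    have h4 : R ^ 2 ≤ |a| ^ 2 + |b| ^ 2 + |c| ^ 2 := by
      rcases max_choice |a| (max |b| |c|) with h | h
      · rw [hR, h]; nlinarith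
      · rcases max_choice |b| |c| with h' | h'
        · rw [hR, h, h']; nlinarith
        · rw [hR, h, h']; nlinarith
    have h0 : 0 ≤ R := ha.trans h1
    nlinarith
  unfold growthRate
  have h1 := hcosh (a + b - c) ((abs_sub _ _).trans (by gcongr; exact abs_add_le _ _))
  have h2 := hcosh (a - b + c) ((abs_add_le _ _).trans (by gcongr; exact abs_sub _ _))
  have h3 := hcosh (-a + b + c) ((abs_add_le _ _).trans (by
    gcongr; exact (abs_add_le _ _).trans (by rw [abs_neg])))
  calc _ ≤ Real.exp (|a| + |b| + |c|) * Real.exp (-((a ^ 2 + b ^ 2 + c ^ 2) / (2 * β))) := by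
        refine mul_le_mul_of_nonneg_right ?_ (Real.exp_pos _).le
        linarith
    _ ≤ 1 := by
        rw [← Real.exp_add, Real.exp_le_one_iff]; linarith

/-- On the cone of margin vectors without a Condorcet winner the rate attains a maximum. -/
theorem exists_isMaxOn_growthRate {β : ℝ} (hβ : 0 < β) :
    ∃ a b c : ℝ, (¬ (0 < a ∧ c < 0) ∧ ¬ (0 < b ∧ a < 0) ∧ ¬ (0 < c ∧ b < 0)) ∧
      ∀ a' b' c' : ℝ, ¬ (0 < a' ∧ c' < 0) → ¬ (0 < b' ∧ a' < 0) → ¬ (0 < c' ∧ b' < 0) →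
        growthRate β a' b' c' ≤ growthRate β a b c := by
  set C : Set (ℝ × ℝ × ℝ) := {p | ¬ (0 < p.1 ∧ p.2.2 < 0) ∧ ¬ (0 < p.2.1 ∧ p.1 < 0) ∧
    ¬ (0 < p.2.2 ∧ p.2.1 < 0)} with hCdef
  let F : ℝ × ℝ × ℝ → ℝ := fun p => growthRate β p.1 p.2.1 p.2.2
  have hcl : ∀ f g : ℝ × ℝ × ℝ → ℝ, Continuous f → Continuous g →
      IsClosed {p | ¬ (0 < f p ∧ g p < 0)} := fun f g hf hg =>
    ((isOpen_lt continuous_const hf).inter (isOpen_lt hg continuous_const)).isClosed_compl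
  have hC : IsClosed C :=
    (hcl _ _ continuous_fst continuous_snd.snd).inter
      ((hcl _ _ continuous_snd.fst continuous_fst).inter
        (hcl _ _ continuous_snd.snd continuous_snd.fst))
  have hF : Continuous F := by unfold F growthRate; fun_prop
  have h0 : (0 : ℝ × ℝ × ℝ) ∈ C := by simp [hCdef]
  -- Coercivity: the origin lies in the closed cone with rate 1, and far away the rate is at most 1.
  have hev : ∀ᶠ p in cocompact (ℝ × ℝ × ℝ) ⊓ 𝓟 C, F p ≤ F 0 := by
    refine Eventually.filter_mono inf_le_left ?_
    filter_upwards [(tendsto_norm_cocompact_atTop (E := ℝ × ℝ × ℝ)).eventually_ge_atTop (6 * β)]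
      with p hp
    have hF0 : F 0 = 1 := by simp [F, growthRate]; norm_num
    rw [hF0]
    exact growthRate_le_one hβ (by simpa [Prod.norm_def, Real.norm_eq_abs] using hp)
  obtain ⟨p, hp, hmax⟩ := hF.continuousOn.exists_isMaxOn' hC h0 hev
  refine ⟨p.1, p.2.1, p.2.2, hp, fun a' b' c' h1 h2 h3 => ?_⟩
  exact isMaxOn_iff.1 hmax (a', b', c') ⟨h1, h2, h3⟩

theorem exists_mul_pow_bound {r : ℝ} (h0 : 0 < r) (h1 : r < 1) :
    ∃ c C : ℝ, 0 < c ∧ ∀ n : ℕ, (2 * n + 1 : ℝ) ^ 3 * r ^ n ≤ C * Real.exp (-c * n) := by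
  -- Write r = s·s: one factor sⁿ absorbs the polynomial, the other provides the decay.
  set s := √r with hs
  have hs0 : 0 < s := Real.sqrt_pos.2 h0
  have hs1 : s < 1 := by rw [hs, Real.sqrt_lt' one_pos]; simpa using h1
  have ht : Tendsto (fun n : ℕ => (2 * n + 1 : ℝ) ^ 3 * s ^ n) atTop (𝓝 0) := by
    have h := fun k => tendsto_pow_const_mul_const_pow_of_lt_one k hs0.le hs1
    have := ((((h 3).const_mul 8).add ((h 2).const_mul 12)).add ((h 1).const_mul 6)).add (h 0)
    simp only [mul_zero, add_zero] at this
    refine this.congr fun n => ?_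
    ring
  obtain ⟨C, hC⟩ := ht.bddAbove_range
  refine ⟨-Real.log s, C, by linarith [Real.log_neg hs0 hs1], fun n => ?_⟩
  have e : Real.exp (- -Real.log s * n) = s ^ n := by
    rw [neg_neg, mul_comm, Real.exp_nat_mul, Real.exp_log hs0]
  rw [e, ← Real.mul_self_sqrt h0.le, mul_pow, ← mul_assoc]
  exact mul_le_mul_of_nonneg_right (hC ⟨n, rfl⟩) (by positivity)

theorem not_mem_condorcetEvent {n : ℕ} {x : Profile 3 n} (hx : x ∉ condorcetEvent 3 n) :
    ¬ (0 < margin x 0 ∧ margin x 2 < 0) ∧ ¬ (0 < margin x 1 ∧ margin x 0 < 0) ∧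
      ¬ (0 < margin x 2 ∧ margin x 1 < 0) := by
  have h : ∀ a, ¬ (0 < margin x a ∧ margin x (a + 2) < 0) := fun a ha =>
    hx ⟨a, (isCondorcetWinner_iff x a).2 ha⟩
  exact ⟨h 0, h 1, h 2⟩

/-- In the low temperature phase the probability of a paradox decays exponentially. -/
theorem exists_prob_compl_le {β : ℝ} (hβ : 3 / 4 < β) :
    ∃ c C : ℝ, 0 < c ∧ ∀ n : ℕ, 1 ≤ n →
      prob 3 n β (condorcetEvent 3 n)ᶜ ≤ C * Real.exp (-c * n) := by
  classical
  have hβ0 : 0 < β := by linarith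
  obtain ⟨a, b, c, ⟨h1, h2, h3⟩, hmax⟩ := exists_isMaxOn_growthRate hβ0
  obtain ⟨a', b', c', hlt⟩ := exists_growthRate_gt hβ h1 h2 h3
  set m := growthRate β a b c
  set M := growthRate β a' b' c'
  have hm : 0 < m := growthRate_pos _ _ _ _
  have hM : 0 < M := growthRate_pos _ _ _ _
  obtain ⟨c, C, hc, hC⟩ := exists_mul_pow_bound (r := m / M) (by positivity)
    ((div_lt_one hM).2 hlt)
  refine ⟨c, C, hc, fun n hn => le_trans ?_ (hC n)⟩
  have hn0 : n ≠ 0 := by omega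
  have hnR : (0 : ℝ) < n := by positivity
  unfold prob
  simp_rw [gibbsMass_eq, ← Finset.sum_div]
  rw [div_le_iff₀ (sum_marginWeight_pos n β)]
  have hup := sum_marginWeight_le (m := m) hn0 hβ0 hm
    (Finset.univ.filter fun x : Profile 3 n => x ∈ (condorcetEvent 3 n)ᶜ) (by
      intro x hx
      obtain ⟨h1, h2, h3⟩ := not_mem_condorcetEvent (Finset.mem_filter.1 hx).2
      have hk : 0 < β / n := by positivity
      have hp : ∀ k, 0 < β / n * (margin x k : ℝ) ↔ 0 < margin x k := fun k => by
        rw [mul_pos_iff_of_pos_left hk]; exact Int.cast_pos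
      have hq : ∀ k, β / n * (margin x k : ℝ) < 0 ↔ margin x k < 0 := fun k => by
        rw [mul_neg_iff]; simp [hk, hk.not_gt]
      apply hmax <;> rwa [hp, hq])
  have hlow := growthRate_pow_le_sum_marginWeight hn0 hβ0 a' b' c'
  have e : (2 * n + 1 : ℝ) ^ 3 * (6 * m) ^ n = (2 * n + 1 : ℝ) ^ 3 * (m / M) ^ n * (6 * M) ^ n := by
    rw [mul_assoc, ← mul_pow]
    congr 2
    field_simp
  calc _ ≤ (2 * n + 1 : ℝ) ^ 3 * (6 * m) ^ n := by convert hup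
    _ = (2 * n + 1 : ℝ) ^ 3 * (m / M) ^ n * (6 * M) ^ n := e
    _ ≤ _ := mul_le_mul_of_nonneg_left hlow (by positivity)

/-- A probability that decays exponentially is at most `2 exp (-c n)` for a suitable rate. -/
theorem exists_le_two_mul_exp {p : ℕ → ℝ} (hp : ∀ n, p n ≤ 1) {c C : ℝ} (hc : 0 < c)
    (h : ∀ n : ℕ, 1 ≤ n → p n ≤ C * Real.exp (-c * n)) :
    ∃ c' : ℝ, 0 < c' ∧ ∀ n : ℕ, 1 ≤ n → p n ≤ 2 * Real.exp (-c' * n) := by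
  set K := max C 2 with hK
  have hK2 : 2 ≤ K := le_max_right _ _
  have hlog2 : 0 < Real.log 2 := Real.log_pos (by norm_num)
  have hlogK : Real.log 2 ≤ Real.log K := Real.log_le_log (by norm_num) hK2
  have hlogK0 : 0 < Real.log K := hlog2.trans_le hlogK
  -- With r = log 2 / log K in (0,1], min(1, y) ≤ yʳ for y = K exp(-cn), and Kʳ = 2.
  refine ⟨c * (Real.log 2 / Real.log K), by positivity, fun n hn => ?_⟩
  set r := Real.log 2 / Real.log K with hr
  have hr0 : 0 < r := by positivity
  have hr1 : r ≤ 1 := (div_le_one hlogK0).2 hlogK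
  have hrK : r * Real.log K = Real.log 2 := by rw [hr]; field_simp
  have e2 : (2 : ℝ) * Real.exp (-(c * r) * n) = Real.exp (r * (Real.log K - c * n)) := by
    rw [mul_sub, hrK, sub_eq_add_neg, Real.exp_add, Real.exp_log (by norm_num)]
    congr 2; ring
  rw [e2]
  have hb : p n ≤ Real.exp (Real.log K - c * n) := by
    refine (h n hn).trans ?_
    rw [sub_eq_add_neg, Real.exp_add, Real.exp_log (by linarith), neg_mul]
    exact mul_le_mul_of_nonneg_right (le_max_left _ _) (Real.exp_pos _).le
  rcases le_total 0 (Real.log K - c * n) with h0 | h0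
  · exact (hp n).trans (Real.one_le_exp (by positivity))
  · refine hb.trans (Real.exp_le_exp.2 ?_)
    nlinarith

theorem exists_prob_compl_le_two_mul_exp {β : ℝ} (hβ : 3 / 4 < β) :
    ∃ c : ℝ, 0 < c ∧ ∀ n : ℕ, 1 ≤ n →
      prob 3 n β (condorcetEvent 3 n)ᶜ ≤ 2 * Real.exp (-c * n) := by
  obtain ⟨c, C, hc, h⟩ := exists_prob_compl_le hβ
  exact exists_le_two_mul_exp (fun n => prob_le_one n β _) hc h

theorem tendsto_prob_condorcetEvent_one {β : ℝ} (hβ : 3 / 4 < β) :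
    Tendsto (fun n : ℕ => prob 3 n β (condorcetEvent 3 n)) atTop (𝓝 1) := by
  obtain ⟨c, hc, h⟩ := exists_prob_compl_le_two_mul_exp hβ
  have hlim : Tendsto (fun n : ℕ => 1 - 2 * Real.exp (-c * n)) atTop (𝓝 1) := by
    have : Tendsto (fun n : ℕ => Real.exp (-c * n)) atTop (𝓝 0) := by
      refine Real.tendsto_exp_atBot.comp ?_
      exact tendsto_natCast_atTop_atTop.const_mul_atTop_of_neg (by linarith)
    simpa using (this.const_mul 2).const_sub 1
  refine tendsto_of_tendsto_of_tendsto_of_le_of_le' hlim tendsto_const_nhds ?_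
    (Eventually.of_forall fun n => prob_le_one n β _)
  filter_upwards [eventually_ge_atTop 1] with n hn
  have := prob_add_prob_compl n β (condorcetEvent 3 n)
  linarith [h n hn]

/-! ### High temperature: sub-Gaussian bounds and the scaling limit. -/

open MeasureTheory ProbabilityTheory

theorem six_pow_mul_factorial_le (n : ℕ) :
    6 ^ (n + 1) * (n + 1).factorial ≤ 3 * (2 * (n + 1)).factorial := by
  induction n with
  | zero => simp [Nat.factorial]
  | succ n ih =>
    have h : (2 * (n + 1 + 1)).factorial =
        (2 * n + 4) * ((2 * n + 3) * (2 * (n + 1)).factorial) := by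
      rw [show 2 * (n + 1 + 1) = 2 * (n + 1) + 1 + 1 by ring, Nat.factorial_succ,
        Nat.factorial_succ]
      ring
    rw [h, pow_succ, Nat.factorial_succ (n + 1)]
    calc 6 ^ (n + 1) * 6 * ((n + 1 + 1) * (n + 1).factorial)
        = (6 * (n + 2)) * (6 ^ (n + 1) * (n + 1).factorial) := by ring
      _ ≤ ((2 * n + 4) * (2 * n + 3)) * (3 * (2 * (n + 1)).factorial) :=
        Nat.mul_le_mul (by nlinarith) ih
      _ = _ := by ring

/-- The average of three hyperbolic cosines is strictly sub-Gaussian. -/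
theorem cosh_add_cosh_add_cosh_le (a b c : ℝ) :
    (Real.cosh a + Real.cosh b + Real.cosh c) / 3 ≤ Real.exp ((a ^ 2 + b ^ 2 + c ^ 2) / 6) := by
  have h1 := (((Real.hasSum_cosh a).add (Real.hasSum_cosh b)).add (Real.hasSum_cosh c)).div_const 3
  have h2 := NormedSpace.expSeries_div_hasSum_exp ((a ^ 2 + b ^ 2 + c ^ 2) / 6)
  rw [← Real.exp_eq_exp_ℝ] at h2
  refine hasSum_le (fun n => ?_) h1 h2
  -- Termwise comparison. Order zero is separate because superadditivity of powers needs a positive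
  -- exponent.
  rcases n with _ | n
  · norm_num
  · rw [pow_mul, pow_mul, pow_mul, ← add_div, ← add_div, div_div, div_pow, div_div]
    have hp : ∀ x y : ℝ, 0 ≤ x → 0 ≤ y → x ^ (n + 1) + y ^ (n + 1) ≤ (x + y) ^ (n + 1) :=
      fun x y hx hy => pow_add_pow_le hx hy (Nat.succ_ne_zero n)
    have h3 : (a ^ 2) ^ (n + 1) + (b ^ 2) ^ (n + 1) + (c ^ 2) ^ (n + 1) ≤
        (a ^ 2 + b ^ 2 + c ^ 2) ^ (n + 1) :=
      (add_le_add_left (hp _ _ (sq_nonneg a) (sq_nonneg b)) _).trans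
        (hp _ _ (by positivity) (sq_nonneg c))
    have h4 : (6 : ℝ) ^ (n + 1) * (n + 1).factorial ≤ (2 * (n + 1)).factorial * 3 := by
      have := six_pow_mul_factorial_le n
      rw [mul_comm 3] at this
      exact_mod_cast this
    exact div_le_div₀ (by positivity) h3 (by positivity) h4

theorem norm_cosh_le (z : ℂ) : ‖Complex.cosh z‖ ≤ Real.cosh z.re := by
  unfold Complex.cosh
  rw [norm_div, Real.cosh_eq]
  simp only [Complex.norm_ofNat]
  gcongr
  refine (norm_add_le _ _).trans ?_
  simp [Complex.norm_exp]

/-- Up to a factor, the covariance form of the vote of a uniformly random ranking. -/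
def voteForm (z : Fin 3 → ℂ) : ℂ :=
  (z 0 + z 1 - z 2) ^ 2 + (z 0 - z 1 + z 2) ^ 2 + (-z 0 + z 1 + z 2) ^ 2

theorem norm_voteComplexMGF_le (z : Fin 3 → ℂ) :
    ‖voteComplexMGF z‖ ≤ Real.exp ((voteForm fun k => ((z k).re : ℂ)).re / 6) := by
  have e : (voteForm fun k => ((z k).re : ℂ)).re = (z 0 + z 1 - z 2).re ^ 2 +
      (z 0 - z 1 + z 2).re ^ 2 + (-z 0 + z 1 + z 2).re ^ 2 := by
    simp only [voteForm]
    norm_cast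
  rw [e]
  refine le_trans ?_ (cosh_add_cosh_add_cosh_le _ _ _)
  unfold voteComplexMGF
  rw [norm_div, Complex.norm_ofNat]
  gcongr
  exact (norm_add₃_le).trans (by gcongr <;> exact norm_cosh_le _)

/-- Since cosh u - 1 = 2 sinh²(u/2), the limit reduces to the derivative of sinh at 0. -/
theorem tendsto_mul_cosh_sub_one (u : ℂ) :
    Tendsto (fun n : ℕ => (n : ℂ) * (Complex.cosh (u / (√n : ℝ)) - 1)) atTop (𝓝 (u ^ 2 / 2)) := by
  have hd : HasDerivAt (fun t : ℝ => Complex.sinh (u / 2 * t)) (u / 2) 0 := by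
    refine HasDerivAt.comp_ofReal (e := fun t => Complex.sinh (u / 2 * t)) ?_
    simpa using ((hasDerivAt_id (((0 : ℝ) : ℂ))).const_mul (u / 2)).csinh
  have hlim : Tendsto (fun n : ℕ => (√(n : ℝ))⁻¹) atTop (𝓝[≠] 0) := by
    refine tendsto_nhdsWithin_iff.2 ⟨?_, ?_⟩
    · exact tendsto_inv_atTop_zero.comp (Real.tendsto_sqrt_atTop.comp tendsto_natCast_atTop_atTop)
    · filter_upwards [eventually_gt_atTop 0] with n hn
      have : (0 : ℝ) < n := by exact_mod_cast hn
      simp only [Set.mem_compl_iff, Set.mem_singleton_iff]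
      positivity
  have h := ((hd.tendsto_slope_zero.comp hlim).pow 2).const_mul 2
  have e : (2 : ℂ) * (u / 2) ^ 2 = u ^ 2 / 2 := by ring
  rw [e] at h
  refine h.congr fun n => ?_
  have h1 : Complex.cosh (u / (√n : ℝ)) - 1 = 2 * Complex.sinh (u / 2 * ((√n)⁻¹ : ℝ)) ^ 2 := by
    have : u / (√n : ℝ) = 2 * (u / 2 * ((√n)⁻¹ : ℝ)) := by push_cast; ring
    rw [this, Complex.cosh_two_mul, Complex.cosh_sq]; ring
  have h2 : ((√n : ℝ) : ℂ) ^ 2 = n := by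
    rw [← Complex.ofReal_pow, Real.sq_sqrt (Nat.cast_nonneg n), Complex.ofReal_natCast]
  rw [h1]
  simp only [Function.comp, inv_inv, zero_add, Complex.ofReal_zero, mul_zero, Complex.sinh_zero,
    sub_zero, Complex.real_smul, mul_pow, h2]
  ring

theorem tendsto_voteComplexMGF_pow (z : Fin 3 → ℂ) :
    Tendsto (fun n : ℕ => voteComplexMGF (fun k => z k / (√n : ℝ)) ^ n) atTop
      (𝓝 (Complex.exp (voteForm z / 6))) := by
  have h := (((tendsto_mul_cosh_sub_one (z 0 + z 1 - z 2)).add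
    (tendsto_mul_cosh_sub_one (z 0 - z 1 + z 2))).add
    (tendsto_mul_cosh_sub_one (-z 0 + z 1 + z 2))).div_const 3
  have e : ((z 0 + z 1 - z 2) ^ 2 / 2 + (z 0 - z 1 + z 2) ^ 2 / 2 + (-z 0 + z 1 + z 2) ^ 2 / 2) / 3 =
      voteForm z / 6 := by
    unfold voteForm; ring
  rw [e] at h
  have h2 := Complex.tendsto_one_add_pow_exp_of_tendsto
    (g := fun n : ℕ => voteComplexMGF (fun k => z k / (√n : ℝ)) - 1) (h.congr fun n => by
      unfold voteComplexMGF
      simp only [add_div, sub_div, neg_div]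
      ring)
  simpa using h2

/-! ### Diagonalization and the Hubbard-Stratonovich transformation. -/

/-- An orthonormal eigenbasis of the covariance of the vote of a uniformly random ranking. -/
noncomputable def voteBasis : Fin 3 → Fin 3 → ℝ :=
  ![![1 / √3, 1 / √3, 1 / √3], ![1 / √2, -(1 / √2), 0], ![1 / √6, 1 / √6, -(2 / √6)]]

/-- The eigenvalues of the covariance of the vote of a uniformly random ranking. -/
noncomputable def voteEigenvalue : Fin 3 → ℝ := ![1 / 3, 4 / 3, 4 / 3]

theorem sum_voteBasis_mul (i j : Fin 3) :
    ∑ k, voteBasis k i * voteBasis k j = if i = j then 1 else 0 := by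
  have h2 : (√2 : ℝ)⁻¹ * (√2)⁻¹ = 1 / 2 := by
    rw [← mul_inv, Real.mul_self_sqrt (by norm_num)]; norm_num
  have h3 : (√3 : ℝ)⁻¹ * (√3)⁻¹ = 1 / 3 := by
    rw [← mul_inv, Real.mul_self_sqrt (by norm_num)]; norm_num
  have h6 : (√6 : ℝ)⁻¹ * (√6)⁻¹ = 1 / 6 := by
    rw [← mul_inv, Real.mul_self_sqrt (by norm_num)]; norm_num
  rw [Fin.sum_univ_three]
  simp only [voteBasis, div_eq_mul_inv, one_mul]
  generalize (√2 : ℝ)⁻¹ = a at *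
  generalize (√3 : ℝ)⁻¹ = b at *
  generalize (√6 : ℝ)⁻¹ = c at *
  fin_cases i <;> fin_cases j <;> simp <;> linarith

theorem sum_sum_voteBasis_sq (s : Fin 3 → ℝ) :
    ∑ k, (∑ j, voteBasis k j * s j) ^ 2 = ∑ j, s j ^ 2 := by
  have h : ∀ k, (∑ j, voteBasis k j * s j) ^ 2 =
      ∑ i, ∑ j, s i * s j * (voteBasis k i * voteBasis k j) := by
    intro k
    rw [sq, Finset.sum_mul_sum]
    exact Finset.sum_congr rfl fun i _ => Finset.sum_congr rfl fun j _ => by ring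
  simp_rw [h]
  rw [Finset.sum_comm]
  refine Finset.sum_congr rfl fun i _ => ?_
  rw [Finset.sum_comm]
  simp_rw [← Finset.mul_sum, sum_voteBasis_mul]
  simp [sq]

theorem sum_sum_voteBasis_mul (s : Fin 3 → ℝ) (i : Fin 3) :
    ∑ k, (∑ j, voteBasis k j * s j) * voteBasis k i = s i := by
  simp_rw [Finset.sum_mul]
  rw [Finset.sum_comm]
  have : ∀ j, ∑ k, voteBasis k j * s j * voteBasis k i = s j * if j = i then 1 else 0 := by
    intro j
    rw [← sum_voteBasis_mul, Finset.mul_sum]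
    exact Finset.sum_congr rfl fun k _ => by ring
  simp_rw [this]
  simp

theorem voteForm_sum_voteBasis (w : Fin 3 → ℂ) :
    voteForm (fun j => ∑ k, w k * voteBasis k j) = 3 * ∑ k, (voteEigenvalue k : ℂ) * w k ^ 2 := by
  have hs : ∀ x : ℝ, 0 ≤ x → ((√x : ℝ) : ℂ)⁻¹ ^ 2 = (x : ℂ)⁻¹ := by
    intro x hx
    rw [inv_pow, ← Complex.ofReal_pow, Real.sq_sqrt hx]
  have h2 := hs 2 (by norm_num)
  have h3 := hs 3 (by norm_num)
  have h6 := hs 6 (by norm_num)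
  simp only [voteForm, Fin.sum_univ_three, voteBasis, voteEigenvalue, div_eq_mul_inv, one_mul]
  simp
  push_cast at h2 h3 h6
  generalize ((√2 : ℝ) : ℂ)⁻¹ = a at *
  generalize ((√3 : ℝ) : ℂ)⁻¹ = b at *
  generalize ((√6 : ℝ) : ℂ)⁻¹ = c at *
  linear_combination 3 * (w 0) ^ 2 * h3 + 8 * (w 1) ^ 2 * h2 + 24 * (w 2) ^ 2 * h6

theorem integrable_cexp_mul_gaussianReal (z : ℂ) :
    Integrable (fun x : ℝ => Complex.exp (z * x)) (gaussianReal 0 1) :=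
  integrable_cexp_mul_of_re_mem_integrableExpSet aemeasurable_id (by
    rw [integrableExpSet_fun_id_gaussianReal]; trivial)

theorem integral_cexp_mul_gaussianReal (z : ℂ) :
    ∫ x : ℝ, Complex.exp (z * x) ∂(gaussianReal 0 1) = Complex.exp (z ^ 2 / 2) := by
  have := complexMGF_id_gaussianReal (μ := 0) (v := 1) z
  simpa [complexMGF] using this

/-- The standard Gaussian measure on `ℝ³`. -/
noncomputable abbrev gaussian₃ : Measure (Fin 3 → ℝ) := Measure.pi fun _ => gaussianReal 0 1

theorem integrable_cexp_sum_gaussian (z : Fin 3 → ℂ) :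
    Integrable (fun g : Fin 3 → ℝ => Complex.exp (∑ k, z k * g k)) gaussian₃ := by
  simp_rw [Complex.exp_sum]
  exact Integrable.fintype_prod (f := fun k (x : ℝ) => Complex.exp (z k * x))
    fun k => integrable_cexp_mul_gaussianReal (z k)

theorem integral_cexp_sum_gaussian (z : Fin 3 → ℂ) :
    ∫ g, Complex.exp (∑ k, z k * g k) ∂gaussian₃ = Complex.exp ((∑ k, z k ^ 2) / 2) := by
  simp_rw [Complex.exp_sum]
  rw [integral_fintype_prod_eq_prod fun k (x : ℝ) => Complex.exp (z k * x)]
  simp_rw [integral_cexp_mul_gaussianReal]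
  rw [← Complex.exp_sum, Finset.sum_div]

/-- The random field of the Hubbard-Stratonovich transformation. -/
noncomputable def randomField (σ : ℂ) (ξ : Fin 3 → ℝ) (g : Fin 3 → ℝ) (j : Fin 3) : ℂ :=
  ∑ k, (σ * g k + (∑ i, voteBasis k i * ξ i : ℝ) * Complex.I) * voteBasis k j

theorem randomField_eq (σ : ℂ) (ξ g : Fin 3 → ℝ) (j : Fin 3) :
    randomField σ ξ g j = ∑ k, σ * g k * voteBasis k j + ξ j * Complex.I := by
  unfold randomField
  simp_rw [add_mul, Finset.sum_add_distrib]
  congr 1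
  rw [← sum_sum_voteBasis_mul ξ j]
  push_cast
  rw [Finset.sum_mul]
  exact Finset.sum_congr rfl fun k _ => by ring

theorem sum_randomField_mul (σ : ℂ) (ξ g : Fin 3 → ℝ) (s : Fin 3 → ℝ) :
    ∑ j, randomField σ ξ g j * s j =
      ∑ k, (σ * (∑ j, voteBasis k j * s j : ℝ)) * g k + (∑ j, ξ j * s j : ℝ) * Complex.I := by
  simp_rw [randomField_eq, add_mul, Finset.sum_add_distrib]
  congr 1
  · simp_rw [Finset.sum_mul]
    rw [Finset.sum_comm]
    refine Finset.sum_congr rfl fun k _ => ?_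
    push_cast
    rw [Finset.mul_sum, Finset.sum_mul]
    exact Finset.sum_congr rfl fun j _ => by ring
  · push_cast
    rw [Finset.sum_mul]
    exact Finset.sum_congr rfl fun k _ => by ring

theorem integrable_cexp_sum_randomField (σ : ℂ) (ξ s : Fin 3 → ℝ) :
    Integrable (fun g => Complex.exp (∑ j, randomField σ ξ g j * s j)) gaussian₃ := by
  simp_rw [sum_randomField_mul, Complex.exp_add]
  exact (integrable_cexp_sum_gaussian _).mul_const _

/-- The **Hubbard-Stratonovich transformation**. -/
theorem integral_cexp_sum_randomField {σ : ℂ} {β : ℝ} (hσ : σ ^ 2 = β) (ξ s : Fin 3 → ℝ) :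
    ∫ g, Complex.exp (∑ j, randomField σ ξ g j * s j) ∂gaussian₃ =
      Real.exp (β / 2 * ∑ j, s j ^ 2) * Complex.exp ((∑ j, ξ j * s j : ℝ) * Complex.I) := by
  simp_rw [sum_randomField_mul, Complex.exp_add]
  rw [integral_mul_const, integral_cexp_sum_gaussian]
  congr 1
  rw [← sum_sum_voteBasis_sq s]
  simp_rw [mul_pow, hσ]
  push_cast
  rw [← Finset.mul_sum]
  congr 1
  ring

theorem sum_marginWeight_mul_cexp {n : ℕ} {σ : ℂ} {β : ℝ} (hσ : σ ^ 2 = β) (ξ : Fin 3 → ℝ) :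
    ∑ x : Profile 3 n, (marginWeight β x : ℂ) *
        Complex.exp ((∑ j, ξ j * (margin x j / √n) : ℝ) * Complex.I) =
      6 ^ n * ∫ g, voteComplexMGF (fun j => randomField σ ξ g j / (√n : ℝ)) ^ n ∂gaussian₃ := by
  have h1 : ∀ x : Profile 3 n, (marginWeight β x : ℂ) *
      Complex.exp ((∑ j, ξ j * (margin x j / √n) : ℝ) * Complex.I) =
      ∫ g, Complex.exp (∑ j, randomField σ ξ g j * (margin x j / √n : ℝ)) ∂gaussian₃ := by
    intro x
    rw [integral_cexp_sum_randomField hσ]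
    congr 2
    unfold marginWeight
    simp_rw [div_pow, Real.sq_sqrt (Nat.cast_nonneg n), ← Finset.sum_div]
    congr 1
    ring
  simp_rw [h1]
  rw [← integral_finsetSum _ fun x _ => integrable_cexp_sum_randomField σ ξ _, ← integral_const_mul]
  congr 1
  ext g
  rw [← mul_pow, ← sum_cexp_margin]
  refine Finset.sum_congr rfl fun x _ => ?_
  congr 1
  refine Finset.sum_congr rfl fun j _ => ?_
  push_cast
  ring

theorem voteForm_randomField (σ : ℂ) (ξ g : Fin 3 → ℝ) :
    voteForm (randomField σ ξ g) = 3 * ∑ k, (voteEigenvalue k : ℂ) *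
      (σ * g k + (∑ i, voteBasis k i * ξ i : ℝ) * Complex.I) ^ 2 :=
  voteForm_sum_voteBasis _

theorem randomField_re (σ : ℂ) (ξ g : Fin 3 → ℝ) (j : Fin 3) :
    (randomField σ ξ g j).re = (randomField σ.re 0 g j) := by
  simp [randomField]

/-- The dominating function for the limit, free of `n` and `ξ`: only real parts enter the bound, and
`ξ` contributes an imaginary shift. -/
theorem norm_voteComplexMGF_randomField_pow_le {n : ℕ} (hn : n ≠ 0) (σ : ℂ) (ξ g : Fin 3 → ℝ) :
    ‖voteComplexMGF (fun j => randomField σ ξ g j / (√n : ℝ)) ^ n‖ ≤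
      ∏ k, Real.exp (voteEigenvalue k * σ.re ^ 2 / 2 * g k ^ 2) := by
  have hn' : (0 : ℝ) < n := by positivity
  rw [norm_pow]
  refine (pow_le_pow_left₀ (norm_nonneg _) (norm_voteComplexMGF_le _) n).trans (le_of_eq ?_)
  rw [← Real.exp_nat_mul, ← Real.exp_sum]
  congr 1
  have hdiv : ∀ (z : Fin 3 → ℂ) (r : ℂ), voteForm (fun k => z k / r) = voteForm z / r ^ 2 := by
    intro z r; unfold voteForm; ring
  have h : (voteForm fun j => (((randomField σ ξ g j / (√n : ℝ)).re : ℝ) : ℂ)) =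
      ((3 * ∑ k, voteEigenvalue k * (σ.re * g k) ^ 2) / n : ℝ) := by
    simp_rw [Complex.div_ofReal_re, Complex.ofReal_div, randomField_re]
    rw [hdiv, voteForm_randomField, ← Complex.ofReal_pow, Real.sq_sqrt hn'.le]
    simp
  rw [h, Complex.ofReal_re]
  simp only [Fin.sum_univ_three]
  field_simp
  ring

theorem integrable_exp_mul_sq_gaussianReal {c : ℝ} (hc : c < 1) :
    Integrable (fun x : ℝ => Real.exp (c / 2 * x ^ 2)) (gaussianReal 0 1) := by
  rw [gaussianReal_of_var_ne_zero 0 one_ne_zero, integrable_withDensity_iff_integrable_smul'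
    (measurable_gaussianPDF 0 1) (ae_of_all _ fun _ => gaussianPDF_lt_top)]
  have := (integrable_exp_neg_mul_sq (b := (1 - c) / 2) (by linarith)).const_mul (√(2 * Real.pi))⁻¹
  refine this.congr (ae_of_all _ fun x => ?_)
  simp only [toReal_gaussianPDF, gaussianPDFReal, smul_eq_mul]
  rw [mul_assoc, ← Real.exp_add]
  simp
  left
  ring

theorem voteEigenvalue_mul_lt_one {β : ℝ} (hβ : β < 3 / 4) (k : Fin 3) :
    voteEigenvalue k * β < 1 := by
  fin_cases k <;> simp [voteEigenvalue] <;> linarith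

theorem tendsto_integral_voteComplexMGF {σ : ℂ} (hσ : σ.re ^ 2 < 3 / 4) (ξ : Fin 3 → ℝ) :
    Tendsto (fun n : ℕ =>
        ∫ g, voteComplexMGF (fun j => randomField σ ξ g j / (√n : ℝ)) ^ n ∂gaussian₃) atTop
      (𝓝 (∏ k, ∫ x : ℝ, Complex.exp (voteEigenvalue k / 2 *
        (σ * x + (∑ i, voteBasis k i * ξ i : ℝ) * Complex.I) ^ 2) ∂(gaussianReal 0 1))) := by
  rw [← integral_fintype_prod_eq_prod]
  refine tendsto_integral_filter_of_dominated_convergence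
    (fun g => ∏ k, Real.exp (voteEigenvalue k * σ.re ^ 2 / 2 * g k ^ 2)) ?_ ?_ ?_ ?_
  · refine Eventually.of_forall fun n => Continuous.aestronglyMeasurable ?_
    unfold voteComplexMGF randomField
    fun_prop
  · filter_upwards [eventually_ne_atTop 0] with n hn
    exact ae_of_all _ fun g => norm_voteComplexMGF_randomField_pow_le hn σ ξ g
  · exact Integrable.fintype_prod
      (f := fun k (x : ℝ) => Real.exp (voteEigenvalue k * σ.re ^ 2 / 2 * x ^ 2))
      fun k => integrable_exp_mul_sq_gaussianReal (voteEigenvalue_mul_lt_one hσ k)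
  · refine ae_of_all _ fun g => ?_
    convert tendsto_voteComplexMGF_pow (randomField σ ξ g) using 2
    rw [voteForm_randomField, ← Complex.exp_sum]
    congr 1
    simp only [Fin.sum_univ_three]
    ring

/-- A Gaussian integral by completing the square. `K` does not depend on `η`, so it cancels against
the normalizing constant and its value is immaterial. -/
theorem exists_integral_cexp_quadratic_gaussianReal {σ : ℂ} {β l : ℝ} (hσ : σ ^ 2 = β)
    (hl : l * β < 1) :
    ∃ K : ℂ, K ≠ 0 ∧ ∀ η : ℝ, ∫ x : ℝ, Complex.exp (l / 2 * (σ * x + η * Complex.I) ^ 2)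
      ∂(gaussianReal 0 1) = K * Complex.exp (-(l / (1 - l * β) * η ^ 2 / 2 : ℝ)) := by
  have hb : (((l * β - 1) / 2 : ℝ) : ℂ).re < 0 := by
    rw [Complex.ofReal_re]; linarith
  have hne : (1 - l * β : ℂ) ≠ 0 := by
    have : (1 - l * β : ℝ) ≠ 0 := by linarith
    exact_mod_cast this
  have hne' : (l * β - 1 : ℂ) ≠ 0 := by rw [← neg_ne_zero, neg_sub]; exact hne
  refine ⟨(√(2 * Real.pi))⁻¹ * (Real.pi / -(((l * β - 1) / 2 : ℝ) : ℂ)) ^ (1 / 2 : ℂ), ?_, fun η => ?_⟩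
  · refine mul_ne_zero ?_ ?_
    · have : (√(2 * Real.pi))⁻¹ ≠ 0 := by positivity
      exact_mod_cast this
    · have h0 : ((l * β - 1) / 2 : ℝ) ≠ 0 := by
        have := hb; rw [Complex.ofReal_re] at this; exact this.ne
      rw [Complex.cpow_def_of_ne_zero]
      · exact Complex.exp_ne_zero _
      · exact div_ne_zero (by exact_mod_cast Real.pi_ne_zero)
          (neg_ne_zero.2 (by exact_mod_cast h0))
  · rw [integral_gaussianReal_eq_integral_smul one_ne_zero]
    have e : ∀ x : ℝ, gaussianPDFReal 0 1 x • Complex.exp (l / 2 * (σ * x + η * Complex.I) ^ 2) =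
        ((√(2 * Real.pi))⁻¹ : ℝ) * Complex.exp ((((l * β - 1) / 2 : ℝ) : ℂ) * x ^ 2 +
          (l * σ * η * Complex.I) * x + (-(l * η ^ 2 / 2))) := by
      intro x
      rw [Complex.real_smul, gaussianPDFReal, Complex.ofReal_mul, Complex.ofReal_exp, mul_assoc,
        ← Complex.exp_add]
      congr 2
      · simp
      · push_cast
        rw [← hσ]
        linear_combination (l * η ^ 2 / 2 : ℂ) * Complex.I_sq
    simp_rw [e]
    rw [integral_const_mul, integral_cexp_quadratic hb, ← mul_assoc]
    congr 2
    push_cast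
    rw [show (l * σ * η * Complex.I) ^ 2 = -(l ^ 2 * β * η ^ 2 : ℂ) by
      rw [mul_pow, mul_pow, mul_pow, hσ, Complex.I_sq]; ring]
    field_simp
    ring

/-- For negative `β` the root is imaginary, and the domination then only sees real part zero. -/
theorem exists_sq_eq (β : ℝ) : ∃ σ : ℂ, σ ^ 2 = β ∧ σ.re ^ 2 = max β 0 := by
  rcases le_total 0 β with h | h
  · refine ⟨(√β : ℝ), ?_, ?_⟩
    · rw [← Complex.ofReal_pow, Real.sq_sqrt h]
    · rw [Complex.ofReal_re, Real.sq_sqrt h, max_eq_left h]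
  · refine ⟨(√(-β) : ℝ) * Complex.I, ?_, ?_⟩
    · rw [mul_pow, ← Complex.ofReal_pow, Real.sq_sqrt (by linarith), Complex.I_sq]; simp
    · simp [h]

/-- In the high temperature phase the characteristic function of the rescaled margins converges
to a Gaussian one. -/
theorem tendsto_sum_gibbsMass_mul_cexp {β : ℝ} (hβ : β < 3 / 4) (ξ : Fin 3 → ℝ) :
    Tendsto (fun n : ℕ => ∑ x : Profile 3 n, (gibbsMass β x : ℂ) *
        Complex.exp ((∑ j, ξ j * (margin x j / √n) : ℝ) * Complex.I)) atTop
      (𝓝 (Complex.exp (-(∑ k, voteEigenvalue k / (1 - voteEigenvalue k * β) *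
        (∑ i, voteBasis k i * ξ i) ^ 2 / 2 : ℝ)))) := by
  obtain ⟨σ, hσ, hre⟩ := exists_sq_eq β
  have hre' : σ.re ^ 2 < 3 / 4 := by rw [hre]; exact max_lt hβ (by norm_num)
  choose K hK0 hK using fun k =>
    exists_integral_cexp_quadratic_gaussianReal hσ (voteEigenvalue_mul_lt_one hβ k)
  have hlim : ∀ ξ : Fin 3 → ℝ, Tendsto (fun n : ℕ =>
        ∫ g, voteComplexMGF (fun j => randomField σ ξ g j / (√n : ℝ)) ^ n ∂gaussian₃) atTop
      (𝓝 ((∏ k, K k) * Complex.exp (-(∑ k, voteEigenvalue k / (1 - voteEigenvalue k * β) *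
        (∑ i, voteBasis k i * ξ i) ^ 2 / 2 : ℝ)))) := by
    intro ξ
    convert tendsto_integral_voteComplexMGF hre' ξ using 2
    simp_rw [hK]
    rw [Finset.prod_mul_distrib, ← Complex.exp_sum]
    push_cast
    rw [Finset.sum_neg_distrib]
  -- At ξ = 0 the same limit describes the partition function; dividing by it removes the constants.
  have h0 := hlim 0
  simp only [Pi.zero_apply, mul_zero, Finset.sum_const_zero, ne_eq, OfNat.ofNat_ne_zero,
    not_false_eq_true, zero_pow, zero_div, Complex.ofReal_zero, neg_zero, Complex.exp_zero,
    mul_one] at h0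
  have hKp : ∏ k, K k ≠ 0 := Finset.prod_ne_zero_iff.2 fun k _ => hK0 k
  have hdiv := (hlim ξ).div h0 hKp
  rw [mul_div_cancel_left₀ _ hKp] at hdiv
  refine hdiv.congr fun n => ?_
  have hZ := sum_marginWeight_mul_cexp (n := n) hσ 0
  simp only [Pi.zero_apply, zero_mul, Finset.sum_const_zero, Complex.ofReal_zero, Complex.exp_zero,
    mul_one] at hZ
  have hN := sum_marginWeight_mul_cexp (n := n) hσ ξ
  simp_rw [gibbsMass_eq]
  push_cast
  push_cast at hN
  simp_rw [div_mul_eq_mul_div, ← Finset.sum_div]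
  rw [hN, hZ, mul_div_mul_left _ _ (pow_ne_zero n (by norm_num))]
  rfl

/-! ### Planar Gaussian measure of cones and quadrants. -/

/-- The standard Gaussian measure on `ℝ²`. -/
noncomputable abbrev gaussian₂ : Measure (ℝ × ℝ) := (gaussianReal 0 1).prod (gaussianReal 0 1)

theorem gaussianPDF_mul_gaussianPDF_polar (r θ : ℝ) :
    gaussianPDF 0 1 (r * Real.cos θ) * gaussianPDF 0 1 (r * Real.sin θ) =
      ENNReal.ofReal ((2 * Real.pi)⁻¹ * Real.exp (-r ^ 2 / 2)) := by
  rw [gaussianPDF, gaussianPDF, ← ENNReal.ofReal_mul (gaussianPDFReal_nonneg _ _ _)]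
  congr 1
  simp only [gaussianPDFReal, NNReal.coe_one, mul_one, sub_zero]
  have h : (√(2 * Real.pi))⁻¹ * (√(2 * Real.pi))⁻¹ = (2 * Real.pi)⁻¹ := by
    rw [← mul_inv, Real.mul_self_sqrt (by positivity)]
  rw [mul_mul_mul_comm, h, ← Real.exp_add]
  congr 2
  linear_combination (-r ^ 2 / 2) * Real.sin_sq_add_cos_sq θ

/-- The standard Gaussian measure of a cone is proportional to its opening angle. -/
theorem exists_gaussian₂_cone : ∃ c : ENNReal, ∀ (S : Set (ℝ × ℝ)) (T : Set ℝ),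
    MeasurableSet S → MeasurableSet T → (∀ r > 0, ∀ θ ∈ Set.Ioo (-Real.pi) Real.pi,
      ((r * Real.cos θ, r * Real.sin θ) ∈ S ↔ θ ∈ T)) →
    gaussian₂ S = c * volume (T ∩ Set.Ioo (-Real.pi) Real.pi) := by
  refine ⟨∫⁻ r in Set.Ioi (0 : ℝ), ENNReal.ofReal r *
    ENNReal.ofReal ((2 * Real.pi)⁻¹ * Real.exp (-r ^ 2 / 2)), fun S T hS hT h => ?_⟩
  have hpdf : Measurable fun p : ℝ × ℝ => gaussianPDF 0 1 p.1 * gaussianPDF 0 1 p.2 :=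
    ((measurable_gaussianPDF 0 1).comp measurable_fst).mul
      ((measurable_gaussianPDF 0 1).comp measurable_snd)
  rw [gaussian₂, gaussianReal_of_var_ne_zero 0 one_ne_zero,
    prod_withDensity (measurable_gaussianPDF 0 1) (measurable_gaussianPDF 0 1),
    withDensity_apply _ hS, ← lintegral_indicator hS, ← Measure.volume_eq_prod,
    ← lintegral_comp_polarCoord_symm]
  have e : ∀ p ∈ polarCoord.target, ENNReal.ofReal p.1 •
      S.indicator (fun p => gaussianPDF 0 1 p.1 * gaussianPDF 0 1 p.2) (polarCoord.symm p) =
      (ENNReal.ofReal p.1 * ENNReal.ofReal ((2 * Real.pi)⁻¹ * Real.exp (-p.1 ^ 2 / 2))) *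
        T.indicator (fun _ => 1) p.2 := by
    rintro ⟨r, θ⟩ ⟨hr, hθ⟩
    have := h r hr θ hθ
    simp only [polarCoord_symm_apply, smul_eq_mul]
    by_cases hT : θ ∈ T
    · rw [Set.indicator_of_mem (this.2 hT), Set.indicator_of_mem hT, mul_one,
        gaussianPDF_mul_gaussianPDF_polar]
    · rw [Set.indicator_of_notMem (mt this.1 hT), Set.indicator_of_notMem hT, mul_zero, mul_zero]
  rw [setLIntegral_congr_fun polarCoord.open_target.measurableSet e, polarCoord_target,
    Measure.volume_eq_prod, ← Measure.prod_restrict,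
    lintegral_prod_mul (f := fun r => ENNReal.ofReal r *
      ENNReal.ofReal ((2 * Real.pi)⁻¹ * Real.exp (-r ^ 2 / 2))) (by fun_prop)
      ((measurable_const.indicator hT).aemeasurable)]
  congr 1
  rw [lintegral_indicator_const hT, one_mul, Measure.restrict_apply hT]

theorem gaussian₂_cone {S : Set (ℝ × ℝ)} {T : Set ℝ} (hS : MeasurableSet S) (hT : MeasurableSet T)
    (h : ∀ r > 0, ∀ θ ∈ Set.Ioo (-Real.pi) Real.pi,
      ((r * Real.cos θ, r * Real.sin θ) ∈ S ↔ θ ∈ T)) :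
    gaussian₂.real S = volume.real (T ∩ Set.Ioo (-Real.pi) Real.pi) / (2 * Real.pi) := by
  obtain ⟨c, hc⟩ := exists_gaussian₂_cone
  -- Total mass one on the whole plane determines the radial constant.
  have h1 := hc Set.univ Set.univ MeasurableSet.univ MeasurableSet.univ (by simp)
  have h2 := congrArg ENNReal.toReal h1
  rw [measure_univ, Set.univ_inter, Real.volume_Ioo, ENNReal.toReal_mul,
    ENNReal.toReal_ofReal (by linarith [Real.pi_pos]), ENNReal.toReal_one] at h2
  rw [measureReal_def, hc S T hS hT h, ENNReal.toReal_mul, ← measureReal_def,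
    eq_div_iff (by positivity)]
  linear_combination (-volume.real (T ∩ Set.Ioo (-Real.pi) Real.pi)) * h2

/-- The standard Gaussian measure of a wedge. -/
theorem gaussian₂_wedge {φ : ℝ} (h0 : 0 ≤ φ) (h1 : φ ≤ Real.pi / 2) :
    gaussian₂.real {p | 0 < p.1 ∧ 0 < Real.cos φ * p.1 + Real.sin φ * p.2} =
      (Real.pi - φ) / (2 * Real.pi) := by
  have hπ := Real.pi_pos
  -- In polar coordinates the conditions are cos θ > 0 and cos(θ - φ) > 0, an arc of length π - φ.
  rw [gaussian₂_cone (T := Set.Ioo (φ - Real.pi / 2) (Real.pi / 2)) ?_ measurableSet_Ioo ?_]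
  · rw [Set.inter_eq_left.2 (Set.Ioo_subset_Ioo (by linarith) (by linarith)), measureReal_def,
      Real.volume_Ioo, ENNReal.toReal_ofReal (by linarith)]
    ring
  · exact (measurableSet_lt measurable_const measurable_fst).inter
      (measurableSet_lt measurable_const
        ((measurable_fst.const_mul (Real.cos φ)).add (measurable_snd.const_mul (Real.sin φ))))
  · rintro r hr θ ⟨hθ1, hθ2⟩
    have e : Real.cos φ * (r * Real.cos θ) + Real.sin φ * (r * Real.sin θ) =
        r * Real.cos (θ - φ) := by
      rw [Real.cos_sub]; ring
    simp only [Set.mem_ofPred_eq, e, mul_pos_iff_of_pos_left hr, Set.mem_Ioo]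
    constructor
    · rintro ⟨hc1, hc2⟩
      constructor
      · by_contra! hle
        by_cases hlt : θ < -(Real.pi / 2)
        · have := Real.cos_nonpos_of_pi_div_two_le_of_le (x := -θ) (by linarith) (by linarith)
          rw [Real.cos_neg] at this
          linarith
        · have := Real.cos_nonpos_of_pi_div_two_le_of_le (x := -(θ - φ)) (by linarith) (by linarith)
          rw [Real.cos_neg] at this
          linarith
      · by_contra! hle
        have := Real.cos_nonpos_of_pi_div_two_le_of_le (x := θ) (by linarith) (by linarith)
        linarith
    · rintro ⟨ht1, ht2⟩
      exact ⟨Real.cos_pos_of_mem_Ioo ⟨by linarith, ht2⟩,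
        Real.cos_pos_of_mem_Ioo ⟨by linarith, by linarith⟩⟩

/-- The linear map that sends a standard Gaussian vector to a centered Gaussian vector whose
coordinates have variance `s ^ 2` and correlation `cos φ`. -/
noncomputable def correlate (s φ : ℝ) (p : ℝ × ℝ) : ℂ :=
  ⟨s * p.1, s * (Real.cos φ * p.1 + Real.sin φ * p.2)⟩

theorem continuous_correlate (s φ : ℝ) : Continuous (correlate s φ) := by
  have : correlate s φ = fun p : ℝ × ℝ => ((s * p.1 : ℝ) : ℂ) +
      ((s * (Real.cos φ * p.1 + Real.sin φ * p.2) : ℝ) : ℂ) * Complex.I := by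
    ext p
    exact Complex.mk_eq_add_mul_I _ _
  rw [this]
  fun_prop

/-- The centered Gaussian law on the plane with variances `s ^ 2` and correlation `cos φ`. -/
noncomputable def correlatedGaussian (s φ : ℝ) : ProbabilityMeasure ℂ :=
  ⟨gaussian₂.map (correlate s φ),
    Measure.isProbabilityMeasure_map (continuous_correlate s φ).aemeasurable⟩

theorem charFun_correlatedGaussian (s φ : ℝ) (t : ℂ) :
    charFun (correlatedGaussian s φ : Measure ℂ) t =
      Complex.exp (-(s ^ 2 * (t.re ^ 2 + 2 * Real.cos φ * t.re * t.im + t.im ^ 2) / 2 : ℝ)) := by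
  have h : charFun (correlatedGaussian s φ : Measure ℂ) t = ∫ p : ℝ × ℝ,
      Complex.exp ((s * (t.re + Real.cos φ * t.im) * Complex.I) * p.1) *
        Complex.exp ((s * Real.sin φ * t.im * Complex.I) * p.2) ∂gaussian₂ := by
    rw [charFun_apply]
    simp only [correlatedGaussian, ProbabilityMeasure.coe_mk]
    rw [integral_map (continuous_correlate s φ).aemeasurable (by fun_prop)]
    congr 1
    ext p
    rw [← Complex.exp_add]
    congr 1
    simp only [correlate, Complex.inner, Complex.mul_re, Complex.conj_re, Complex.conj_im]
    push_cast
    ring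
  rw [h, integral_prod_mul (fun x : ℝ => Complex.exp ((s * (t.re + Real.cos φ * t.im) * Complex.I) * x))
    (fun y : ℝ => Complex.exp ((s * Real.sin φ * t.im * Complex.I) * y)),
    integral_cexp_mul_gaussianReal, integral_cexp_mul_gaussianReal, ← Complex.exp_add]
  congr 1
  have h1 : (Real.sin φ : ℂ) ^ 2 + (Real.cos φ : ℂ) ^ 2 = 1 := by
    exact_mod_cast Real.sin_sq_add_cos_sq φ
  push_cast at h1 ⊢
  simp only [mul_pow, Complex.I_sq]
  linear_combination (-(s : ℂ) ^ 2 * t.im ^ 2 / 2) * h1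

/-- The open first quadrant. -/
def quadrant : Set ℂ := {z | 0 < z.re ∧ 0 < z.im}

theorem isOpen_quadrant : IsOpen quadrant :=
  (isOpen_lt continuous_const Complex.continuous_re).inter
    (isOpen_lt continuous_const Complex.continuous_im)

theorem frontier_quadrant_subset : frontier quadrant ⊆ {z | 0 = z.re} ∪ {z | 0 = z.im} := by
  refine (frontier_inter_subset {z : ℂ | 0 < z.re} {z | 0 < z.im}).trans (Set.union_subset_union ?_ ?_)
  · exact Set.inter_subset_left.trans
      (frontier_lt_subset_eq continuous_const Complex.continuous_re)
  · exact Set.inter_subset_right.trans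
      (frontier_lt_subset_eq continuous_const Complex.continuous_im)

theorem correlatedGaussian_quadrant {s φ : ℝ} (hs : 0 < s) (h0 : 0 ≤ φ) (h1 : φ ≤ Real.pi / 2) :
    (correlatedGaussian s φ : Measure ℂ).real quadrant = (Real.pi - φ) / (2 * Real.pi) := by
  rw [← gaussian₂_wedge h0 h1, measureReal_def, measureReal_def]
  simp only [correlatedGaussian, ProbabilityMeasure.coe_mk]
  rw [Measure.map_apply (continuous_correlate s φ).measurable isOpen_quadrant.measurableSet]
  congr 2
  ext p
  simp [quadrant, correlate, hs]

theorem correlatedGaussian_frontier_quadrant {s φ : ℝ} (hs : 0 < s) (hφ : Real.sin φ ≠ 0) :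
    (correlatedGaussian s φ : Measure ℂ) (frontier quadrant) = 0 := by
  have : NullSingletonClass (gaussianReal 0 1) := nullSingletonClass_gaussianReal one_ne_zero
  refine measure_mono_null frontier_quadrant_subset (measure_union_null ?_ ?_)
  · simp only [correlatedGaussian, ProbabilityMeasure.coe_mk]
    rw [Measure.map_apply (continuous_correlate s φ).measurable
      (measurableSet_eq_fun measurable_const Complex.measurable_re)]
    have e : correlate s φ ⁻¹' {z | 0 = z.re} = {0} ×ˢ Set.univ := by
      ext p
      simp [correlate, hs.ne', eq_comm]
    rw [e, Measure.prod_prod, measure_singleton, zero_mul]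
  · simp only [correlatedGaussian, ProbabilityMeasure.coe_mk]
    have hm := measurableSet_eq_fun (measurable_const (a := (0 : ℝ))) Complex.measurable_im
    rw [Measure.map_apply (continuous_correlate s φ).measurable hm]
    refine Measure.measure_prod_null_of_ae_null ((continuous_correlate s φ).measurable hm)
      (ae_of_all _ fun x => ?_)
    refine measure_mono_null (t := {-(Real.cos φ * x) / Real.sin φ}) ?_ (measure_singleton _)
    intro y hy
    have hy' : 0 = s * (Real.cos φ * x + Real.sin φ * y) := hy
    have : Real.cos φ * x + Real.sin φ * y = 0 := by
      rcases mul_eq_zero.1 hy'.symm with h | h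
      · exact absurd h hs.ne'
      · exact h
    rw [Set.mem_singleton_iff, eq_div_iff hφ]
    linarith

/-! ### Convergence in law of the margins and the limiting probability. -/

/-- The two rescaled margins of candidate `a` over the other two candidates. -/
noncomputable def rescaledMargins {n : ℕ} (a : Fin 3) (x : Profile 3 n) : ℂ :=
  ⟨margin x a / √n, -(margin x (a + 2) / √n)⟩

/-- The law of the rescaled margins of candidate `a` under the mean-field model. -/
noncomputable def marginLaw (β : ℝ) (a : Fin 3) (n : ℕ) : ProbabilityMeasure ℂ :=
  ⟨∑ x : Profile 3 n, ENNReal.ofReal (gibbsMass β x) • Measure.dirac (rescaledMargins a x), ⟨by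
    simp only [Measure.coe_finsetSum, Finset.sum_apply, Measure.smul_apply, measure_univ,
      smul_eq_mul, mul_one]
    rw [← ENNReal.ofReal_sum_of_nonneg fun _ _ => gibbsMass_nonneg _ _, sum_gibbsMass,
      ENNReal.ofReal_one]⟩⟩

theorem charFun_marginLaw (β : ℝ) (a : Fin 3) (n : ℕ) (t : ℂ) :
    charFun (marginLaw β a n : Measure ℂ) t = ∑ x : Profile 3 n, (gibbsMass β x : ℂ) *
      Complex.exp ((∑ j, (Pi.single a t.re - Pi.single (a + 2) t.im : Fin 3 → ℝ) j *
        (margin x j / √n) : ℝ) * Complex.I) := by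
  simp only [marginLaw, ProbabilityMeasure.coe_mk, charFun_apply]
  rw [integral_finsetSum_measure fun x _ => (integrable_dirac (by simp)).smul_measure (by simp)]
  refine Finset.sum_congr rfl fun x _ => ?_
  rw [integral_smul_measure, integral_dirac, ENNReal.toReal_ofReal (gibbsMass_nonneg _ _),
    Complex.real_smul]
  congr 4
  simp only [Pi.sub_apply, sub_mul, Finset.sum_sub_distrib, Pi.single_apply, ite_mul, zero_mul,
    Finset.sum_ite_eq', Finset.mem_univ, if_true, rescaledMargins, Complex.inner, Complex.mul_re,
    Complex.conj_re, Complex.conj_im]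
  ring

theorem marginLaw_quadrant {β : ℝ} {n : ℕ} (hn : n ≠ 0) (a : Fin 3) :
    (marginLaw β a n : Measure ℂ).real quadrant = prob 3 n β {x | IsCondorcetWinner x a} := by
  classical
  have hn' : 0 < √(n : ℝ) := Real.sqrt_pos.2 (by positivity)
  have hmem : ∀ x : Profile 3 n, rescaledMargins a x ∈ quadrant ↔ IsCondorcetWinner x a := by
    intro x
    rw [isCondorcetWinner_iff]
    simp only [quadrant, rescaledMargins, Set.mem_ofPred_eq, Left.neg_pos_iff]
    rw [div_pos_iff_of_pos_right hn', div_neg_iff]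
    simp [hn', hn'.not_gt]
  simp only [marginLaw, ProbabilityMeasure.coe_mk, measureReal_def, Measure.coe_finsetSum,
    Finset.sum_apply, Measure.smul_apply, smul_eq_mul]
  rw [ENNReal.toReal_sum fun x _ => ENNReal.mul_ne_top ENNReal.ofReal_ne_top (measure_ne_top _ _)]
  unfold prob
  rw [Finset.sum_filter]
  refine Finset.sum_congr (by congr) fun x _ => ?_
  rw [Measure.dirac_apply' _ isOpen_quadrant.measurableSet, ENNReal.toReal_mul,
    ENNReal.toReal_ofReal (gibbsMass_nonneg _ _)]
  by_cases h : IsCondorcetWinner x a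
  · simp [Set.indicator_of_mem ((hmem x).2 h), h]
  · simp [Set.indicator_of_notMem (mt (hmem x).1 h), h]

theorem prob_condorcetEvent (n : ℕ) (β : ℝ) :
    prob 3 n β (condorcetEvent 3 n) = ∑ a, prob 3 n β {x | IsCondorcetWinner x a} := by
  classical
  unfold prob
  simp_rw [Finset.sum_filter]
  rw [Finset.sum_comm]
  refine Finset.sum_congr rfl fun x _ => ?_
  by_cases h : ∃ a, IsCondorcetWinner x a
  · obtain ⟨a, ha⟩ := h
    rw [if_pos (show x ∈ condorcetEvent 3 n from ⟨a, ha⟩),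
      Finset.sum_eq_single a (fun b _ hb => if_neg fun hxb => hb (hxb.unique ha)) (by simp),
      if_pos (show x ∈ {x | IsCondorcetWinner x a} from ha)]
  · rw [if_neg (show x ∉ condorcetEvent 3 n from h)]
    exact (Finset.sum_eq_zero fun a _ => if_neg fun ha => h ⟨a, ha⟩).symm

/-- The first basis vector is (1,1,1)/√3, so its coordinate is determined by u - v. The other two
share an eigenvalue, so Parseval gives their joint contribution. -/
theorem sum_voteEigenvalue_quadratic {β : ℝ} (hβ : β < 3 / 4) (a : Fin 3) (u v : ℝ) :
    ∑ k, voteEigenvalue k / (1 - voteEigenvalue k * β) *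
      (∑ i, voteBasis k i * (Pi.single a u - Pi.single (a + 2) v : Fin 3 → ℝ) i) ^ 2 / 2 =
    (9 - 4 * β) / ((3 - β) * (3 - 4 * β)) *
      (u ^ 2 + 2 * (3 / (9 - 4 * β)) * u * v + v ^ 2) / 2 := by
  set ξ : Fin 3 → ℝ := Pi.single a u - Pi.single (a + 2) v with hξ
  have hsq : ∑ i, ξ i ^ 2 = u ^ 2 + v ^ 2 := by
    rw [Fin.sum_univ_three]
    fin_cases a <;> simp [hξ] <;> ring
  have hsum : ξ 0 + ξ 1 + ξ 2 = u - v := by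
    fin_cases a <;> simp [hξ] <;> ring
  have hp := sum_sum_voteBasis_sq ξ
  have h0 : (∑ i, voteBasis 0 i * ξ i) ^ 2 = (u - v) ^ 2 / 3 := by
    have h3 : (√3 : ℝ)⁻¹ ^ 2 = 1 / 3 := by
      rw [inv_pow, Real.sq_sqrt (by norm_num)]; norm_num
    rw [← hsum, Fin.sum_univ_three]
    simp only [voteBasis, Matrix.cons_val_zero, Matrix.cons_val_one, Matrix.cons_val, one_div]
    linear_combination (ξ 0 + ξ 1 + ξ 2) ^ 2 * h3
  rw [hsq, Fin.sum_univ_three, h0] at hp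
  rw [Fin.sum_univ_three, h0]
  simp only [voteEigenvalue, Matrix.cons_val_zero, Matrix.cons_val_one, Matrix.cons_val]
  have hb : 0 < 3 - 4 * β := by linarith
  have hA : (1 / 3 : ℝ) / (1 - 1 / 3 * β) = 1 / (3 - β) := by
    have : 0 < 3 - β := by linarith
    have : 0 < 1 - 1 / 3 * β := by linarith
    field_simp
  have hB : (4 / 3 : ℝ) / (1 - 4 / 3 * β) = 4 / (3 - 4 * β) := by
    have : 0 < 1 - 4 / 3 * β := by linarith
    field_simp
  rw [hA, hB]
  have hrest : 4 / (3 - 4 * β) * (∑ i, voteBasis 1 i * ξ i) ^ 2 / 2 +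
      4 / (3 - 4 * β) * (∑ i, voteBasis 2 i * ξ i) ^ 2 / 2 =
      4 / (3 - 4 * β) * (u ^ 2 + v ^ 2 - (u - v) ^ 2 / 3) / 2 := by
    linear_combination 4 / (3 - 4 * β) / 2 * hp
  rw [add_assoc, hrest]
  have h9 : 9 - 4 * β = 3 - 4 * β + 6 := by ring
  have h3 : 3 - β = (3 - 4 * β + 9) / 4 := by ring
  rw [h9, h3]
  generalize 3 - 4 * β = q at hb
  field_simp
  ring

theorem tendsto_marginLaw {β : ℝ} (hβ : β < 3 / 4) (a : Fin 3) :
    Tendsto (marginLaw β a) atTop (𝓝 (correlatedGaussian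
      (√((9 - 4 * β) / ((3 - β) * (3 - 4 * β)))) (Real.arccos (3 / (9 - 4 * β))))) := by
  refine ProbabilityMeasure.tendsto_iff_tendsto_charFun.2 fun t => ?_
  have h1 : 0 < 9 - 4 * β := by linarith
  have h2 : 0 < 3 - β := by linarith
  have h3 : 0 < 3 - 4 * β := by linarith
  have h4 : 3 / (9 - 4 * β) ≤ 1 := (div_le_one h1).2 (by linarith)
  have h5 : 0 ≤ 3 / (9 - 4 * β) := by positivity
  simp_rw [charFun_marginLaw]
  rw [charFun_correlatedGaussian, Real.sq_sqrt (by positivity), Real.cos_arccos (by linarith) h4,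
    ← sum_voteEigenvalue_quadratic hβ a]
  exact tendsto_sum_gibbsMass_mul_cexp hβ _

theorem tendsto_prob_isCondorcetWinner {β : ℝ} (hβ : β < 3 / 4) (a : Fin 3) :
    Tendsto (fun n : ℕ => prob 3 n β {x | IsCondorcetWinner x a}) atTop
      (𝓝 (Real.arccos (3 / (4 * β - 9)) / (2 * Real.pi))) := by
  have h1 : 0 < 9 - 4 * β := by linarith
  have h2 : 0 < 3 - β := by linarith
  have h3 : 0 < 3 - 4 * β := by linarith
  have h4 : 3 / (9 - 4 * β) < 1 := (div_lt_one h1).2 (by linarith)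
  have h5 : 0 < 3 / (9 - 4 * β) := by positivity
  have hs : 0 < √((9 - 4 * β) / ((3 - β) * (3 - 4 * β))) := Real.sqrt_pos.2 (by positivity)
  have hφ : Real.sin (Real.arccos (3 / (9 - 4 * β))) ≠ 0 := by
    rw [Real.sin_arccos]
    exact (Real.sqrt_pos.2 (by nlinarith)).ne'
  -- Portmanteau: the correlation is below 1, so the limit law is nondegenerate and does not charge
  -- the boundary of the quadrant.
  have h := ProbabilityMeasure.tendsto_measure_of_null_frontier_of_tendsto'
    (tendsto_marginLaw hβ a) (correlatedGaussian_frontier_quadrant hs hφ)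
  have h' := (ENNReal.tendsto_toReal (measure_ne_top _ _)).comp h
  have e : Real.arccos (3 / (4 * β - 9)) = Real.pi - Real.arccos (3 / (9 - 4 * β)) := by
    rw [← Real.arccos_neg, ← div_neg, neg_sub]
  rw [e, ← correlatedGaussian_quadrant hs (Real.arccos_nonneg _)
    (Real.arccos_le_pi_div_two.2 h5.le)]
  refine h'.congr' ?_
  filter_upwards [eventually_ne_atTop 0] with n hn
  exact marginLaw_quadrant hn a

theorem tendsto_prob_condorcetEvent {β : ℝ} (hβ : β < 3 / 4) :
    Tendsto (fun n : ℕ => prob 3 n β (condorcetEvent 3 n)) atTop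
      (𝓝 (3 / (2 * Real.pi) * Real.arccos (3 / (4 * β - 9)))) := by
  simp_rw [prob_condorcetEvent]
  convert tendsto_finsetSum Finset.univ fun a _ => tendsto_prob_isCondorcetWinner hβ a using 2
  simp
  ring

end MeanFieldVoting

theorem theorem2 (β : ℝ) :
    (β < 3 / 4 →
      Tendsto (fun n : ℕ => MeanFieldVoting.prob 3 n β (MeanFieldVoting.condorcetEvent 3 n)) atTop
        (𝓝 (3 / (2 * Real.pi) * Real.arccos (3 / (4 * β - 9))))) ∧
    (3 / 4 < β →
      Tendsto (fun n : ℕ => MeanFieldVoting.prob 3 n β (MeanFieldVoting.condorcetEvent 3 n)) atTop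
        (𝓝 1) ∧
      ∃ c : ℝ, 0 < c ∧ ∀ n : ℕ, 1 ≤ n →
        MeanFieldVoting.prob 3 n β (MeanFieldVoting.condorcetEvent 3 n)ᶜ ≤
          2 * Real.exp (-c * (n : ℝ))) :=
  ⟨MeanFieldVoting.tendsto_prob_condorcetEvent, fun hβ =>
    ⟨MeanFieldVoting.tendsto_prob_condorcetEvent_one hβ,
      MeanFieldVoting.exists_prob_compl_le_two_mul_exp hβ⟩⟩
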